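/- Let $n\ge 0$, let $Z=(z_0,\dots,z_n)$ be the homogeneous coordinates of $\mathbb{CP}^n$, and let $\Lambda=(\Lambda^{\alpha\beta})_{0\le\alpha,\beta\le n}$ be a matrix of polynomials $\Lambda^{\alpha\beta}\in\mathbb C[z_0,\dots,z_n]$ such that (summation over repeated indices) (i) $\Lambda^{\alpha\beta}=-\Lambda^{\beta\alpha}$; (ii) $\Lambda^{\alpha\delta}\partial_\delta\Lambda^{\beta\gamma}+\Lambda^{\beta\delta}\partial_\delta\Lambda^{\gamma\alpha}+\Lambda^{\gamma\delta}\partial_\delta\Lambda^{\alpha\beta}=0$ (Jacobi rule); (iii) for all $k$, as operators on pairs of polynomials, $$(\overleftarrow{\partial}_{\alpha_1}\Lambda^{\alpha_1\beta_1}\overrightarrow{\partial}_{\beta_1})\cdots(\overleftarrow{\partial}_{\alpha_k}\Lambda^{\alpha_k\beta_k}\overrightarrow{\partial}_{\beta_k})=\overleftarrow{\partial}_{\alpha_1\cdots\alpha_k}\Lambda^{\alpha_1\beta_1}\cdots\Lambda^{\alpha_k\beta_k}\overrightarrow{\partial}_{\beta_1\cdots\beta_k},$$ where on the left-hand side every $\overleftarrow\partial$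 differentiates everything on its left and every $\overrightarrow\partial$ everything on its right, the coefficients $\Lambda^{\alpha\beta}$ included. For formal series in $\mu,\mu^{-1}$ with coefficients depending on $Z$ put $$f\# g=\sum_{k\ge0}\frac1{k!}\Big(\frac\mu2\Big)^k\Lambda^{\alpha_1\beta_1}\cdots\Lambda^{\alpha_k\beta_k}\,(\partial_{\alpha_1}\cdots\partial_{\alpha_k}f)\,(\partial_{\beta_1}\cdots\partial_{\beta_k}g).$$ Let $A$ be a complex symmetric $(n+1)\times(n+1)$ matrix, $A[Z]=ZA\,{}^tZ$, and let $W$ be the set of all $(t,Z)\in\mathbb C\times\mathbb C^{n+1}$ such that $\det\frac{e^{st\Lambda(Z) A}+e^{-st\Lambda(Z) A}}2\neq0$ for all $s\in[0,1]$. For an open set $D\subseteq\mathbb C\times\mathbb C^{n+1}$ that contains with $(t,Z)$ all $(st,Z)$, $0\le s\le 1$, a $\#$-exponential $e_\#^{tA[Z]/\mu}$ on $D$ is a formal series $F=\sum_m\mu^mF_m(t,Z)$ with finitely many positive powers of $\mu$ and coefficients $F_m$ holomorphic on $D$ that satisfies $\partial_tF=\frac1\mu A[Z]\#F$ and $F|_{t=0}=1$.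 Then: (a) $W$ is open, contains with $(t,Z)$ all $(st,Z)$, $0\le s\le1$, and a $\#$-exponential $F$ exists on $W$. Its Taylor coefficients at $t=0$ are those of the exponential series: $\partial_t^NF|_{t=0}$ is the $N$-fold product $\frac1\mu A[Z]\#(\frac1\mu A[Z]\#\cdots(\frac1\mu A[Z]\#1))$. If $G$ is a $\#$-exponential on some $D$ as above, then $D\subseteq W$ and $G=F$ on $D$. (b) On $W$, and in particular at $t=1$, $$e_\#^{\frac t\mu A[Z]}=\det{}^{-1/2}\Big(\frac{e^{t\Lambda A}+e^{-t\Lambda A}}2\Big)\cdot\exp\Big(\frac1\mu\Big(\frac{\Lambda^{-1}}{\sqrt{-1}}\tan(\sqrt{-1}\,t\Lambda A)\Big)[Z]\Big).$$ Here $\det^{-1/2}$ is the branch that is continuous on $W$ and equal to $1$ at $t=0$; $\exp(q/\mu)$ is the formal series $\sum_{j\ge 0}q^j\mu^{-j}/j!$; and $\frac{\Lambda^{-1}}{\sqrt{-1}}\tan(\sqrt{-1}\,t\Lambda A)$ means $T=tA\,S(t\Lambda A)\cosh(t\Lambda A)^{-1}$ with the entire function $S(x)=\sinh(x)/x$. This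 $T$ always satisfies $\Lambda T=\frac1{\sqrt{-1}}\tan(\sqrt{-1}\,t\Lambda A)$, so that it is the literal expression wherever $\Lambda(Z)$ is invertible. (c) If $(1,0)\in W$, then $e_\#^{\frac1\mu A[Z]}=F|_{t=1}$ lies in $\sum_{k=0}^\infty H^0(\mathbb{CP}^n,\mathcal O(k)[\mu,\mu^{-1}]])$, where $H^0(\mathbb{CP}^n,\mathcal O(k))$ is the space of holomorphic functions on $\mathbb C^{n+1}\setminus\{0\}$ that are homogeneous of degree $k$: there are $s_k=\sum_j s_{k,j}\,\mu^{-j}$ with $s_{k,j}\in H^0(\mathbb{CP}^n,\mathcal O(k))$, and $s_{k,j}=0$ unless $0\le 2j\le k$, such that for every $j$ the coefficient of $\mu^{-j}$ in $e_\#^{\frac1\mu A[Z]}$ equals $\sum_k s_{k,j}(Z)$ for all $Z\ne 0$ near $0$. If $\Lambda$ is constant, then moreover $s_{k,j}=0$ unless $k=2j$, and the coefficient of $\mu^{-j}$ equals $s_{2j,j}(Z)$ for all $Z\neq0$. -/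

import Mathlib

open scoped Topology Matrix LinearAlgebra.Projectivization

noncomputable section

namespace SymbolCalculus

/-- The space `ℂ^{n+1}` of homogeneous coordinates `Z = (z_0, …, z_n)` of `ℂP^n`. -/
abbrev V (n : ℕ) : Type := Fin (n + 1) → ℂ

/-! ### The sheaves `O(k)` on `ℂP^n` and their global sections -/

/-- The punctured cone over a subset `U` of `ℂP^n`. -/
def cone {n : ℕ} (U : Set (ℙ ℂ (V n))) : Set (V n) :=
  {z | ∃ h : z ≠ 0, Projectivization.mk ℂ z h ∈ U}

/-- The sections of `O(k)` over an open set `U`: the holomorphic functions on the punctured cone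
over `U` that are homogeneous of degree `k`. -/
def twistedSections (n k : ℕ) (U : Set (ℙ ℂ (V n))) : Submodule ℂ (cone U → ℂ) where
  carrier := {f | DifferentiableOn ℂ (Function.extend Subtype.val f 0) (cone U) ∧
    ∀ (c : ℂ) (z w : cone U), (w : V n) = c • (z : V n) → f w = c ^ k * f z}
  zero_mem' := by
    refine ⟨?_, fun c z w _ => by simp⟩
    refine (differentiableOn_const (0 : ℂ)).congr fun z hz => ?_
    exact Subtype.val_injective.extend_apply (0 : cone U → ℂ) 0 ⟨z, hz⟩
  add_mem' := by
    rintro f g ⟨hf, hf'⟩ ⟨hg, hg'⟩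
    refine ⟨?_, fun c z w h => ?_⟩
    · refine (hf.add hg).congr fun z hz => ?_
      have e (u : cone U → ℂ) : Function.extend Subtype.val u 0 z = u ⟨z, hz⟩ :=
        Subtype.val_injective.extend_apply u 0 ⟨z, hz⟩
      simp [e]
    · simp only [Pi.add_apply, hf' c z w h, hg' c z w h]
      ring
  smul_mem' := by
    rintro a f ⟨hf, hf'⟩
    refine ⟨?_, fun c z w h => ?_⟩
    · refine (hf.const_smul a).congr fun z hz => ?_
      have e (u : cone U → ℂ) : Function.extend Subtype.val u 0 z = u ⟨z, hz⟩ :=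
        Subtype.val_injective.extend_apply u 0 ⟨z, hz⟩
      simp [e]
    · simp only [Pi.smul_apply, smul_eq_mul, hf' c z w h]
      ring

/-- `H⁰(ℂP^n, O(k))`. -/
abbrev H0 (n k : ℕ) : Type := twistedSections n k Set.univ

/-- The value of a global section of `O(k)` at a nonzero vector of homogeneous coordinates. -/
def H0.value {n k : ℕ} (s : H0 n k) (z : V n) (h : z ≠ 0) : ℂ :=
  s.1 ⟨z, h, Set.mem_univ _⟩

/-! ### The assumptions on `Λ`

The coefficients `Λ^{αβ}` of the biderivation are polynomials in the homogeneous coordinates. -/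

variable {n : ℕ}

/-- `Λ^{αβ} = -Λ^{βα}`. -/
def IsSkew (Λ : Matrix (Fin (n + 1)) (Fin (n + 1)) (MvPolynomial (Fin (n + 1)) ℂ)) : Prop :=
  ∀ α β, Λ α β = -Λ β α

/-- The Jacobi rule for the bracket `{f, g} = Λ^{αβ} ∂_α f ∂_β g`, in coordinates. -/
def IsJacobi (Λ : Matrix (Fin (n + 1)) (Fin (n + 1)) (MvPolynomial (Fin (n + 1)) ℂ)) : Prop :=
  ∀ α β γ, ∑ δ, (Λ α δ * MvPolynomial.pderiv δ (Λ β γ) +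
    Λ β δ * MvPolynomial.pderiv δ (Λ γ α) + Λ γ δ * MvPolynomial.pderiv δ (Λ α β)) = 0

/-- `∂_{α_1} ⋯ ∂_{α_k} f` for a polynomial `f` and the list `[α_1, …, α_k]`. -/
def polyPartials (l : List (Fin (n + 1))) (f : MvPolynomial (Fin (n + 1)) ℂ) :
    MvPolynomial (Fin (n + 1)) ℂ :=
  l.foldr (fun α h => MvPolynomial.pderiv α h) f

/-- All ways to distribute the entries of a list over two lists (used for the Leibniz rule). -/
def splits {ι : Type} : List ι → List (List ι × List ι)
  | [] => [([], [])]
  | b :: l => (splits l).flatMap fun q => [(b :: q.1, q.2), (q.1, b :: q.2)]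

/-- Evaluation, from the left to the right, of the operator word
`u · →∂_l · (←∂_α Λ^{αβ} →∂_β) ⋯ (←∂_α Λ^{αβ} →∂_β) · g` with `k` factors, in which every `←∂`
differentiates everything on its left, and every `→∂` everything on its right, the
coefficients `Λ^{αβ}` included. Here `u` is what has been collected so far on the left, and `l` is
the list of the indices of the derivatives to the right that have not yet found their target: at
each new coefficient `Λ^{αβ}` the Leibniz rule distributes them over `Λ^{αβ}` and the rest. -/
def arrowWord (Λ : Matrix (Fin (n + 1)) (Fin (n + 1)) (MvPolynomial (Fin (n + 1)) ℂ))
    (g : MvPolynomial (Fin (n + 1)) ℂ) :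
    ℕ → MvPolynomial (Fin (n + 1)) ℂ → List (Fin (n + 1)) → MvPolynomial (Fin (n + 1)) ℂ
  | 0, u, l => u * polyPartials l g
  | k + 1, u, l => ∑ α, ∑ β, ((splits l).map fun q =>
      arrowWord Λ g k (MvPolynomial.pderiv α u * polyPartials q.1 (Λ α β)) (q.2 ++ [β])).sum

/-- The relation
`(←∂_{α_1} Λ^{α_1 β_1} →∂_{β_1}) ⋯ (←∂_{α_k} Λ^{α_k β_k} →∂_{β_k})
  = ←∂_{α_1 … α_k} Λ^{α_1 β_1} ⋯ Λ^{α_k β_k} →∂_{β_1 … β_k}` for all `k`. -/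
def LambdaRelation
    (Λ : Matrix (Fin (n + 1)) (Fin (n + 1)) (MvPolynomial (Fin (n + 1)) ℂ)) : Prop :=
  ∀ (k : ℕ) (f g : MvPolynomial (Fin (n + 1)) ℂ),
    arrowWord Λ g k f [] =
      ∑ α : Fin k → Fin (n + 1), ∑ β : Fin k → Fin (n + 1),
        (∏ i, Λ (α i) (β i)) *
          polyPartials (List.ofFn α) f * polyPartials (List.ofFn β) g

/-- The complex matrix `Λ(z)`. -/
def matAt (Λ : Matrix (Fin (n + 1)) (Fin (n + 1)) (MvPolynomial (Fin (n + 1)) ℂ)) (z : V n) :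
    Matrix (Fin (n + 1)) (Fin (n + 1)) ℂ :=
  Λ.map (MvPolynomial.eval z)

/-! ### The product `#`

A formal series `∑_m μ^m f_m` whose coefficients are functions of `Z` is the family
`f : ℤ → V n → ℂ`. -/

/-- The partial derivative `∂f/∂z_α`. -/
def partialD (α : Fin (n + 1)) (f : V n → ℂ) : V n → ℂ :=
  fun z => fderiv ℂ f z (Pi.single α 1)

/-- `∂_{α_1} ⋯ ∂_{α_k} f` for the list `[α_1, …, α_k]`. -/
def partials (l : List (Fin (n + 1))) (f : V n → ℂ) : V n → ℂ :=
  l.foldr partialD f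

/-- `Λ^{α_1 β_1} ⋯ Λ^{α_k β_k} (∂_{α_1} ⋯ ∂_{α_k} f) (∂_{β_1} ⋯ ∂_{β_k} g)`, summed over all
indices. -/
def bidiff (Λ : Matrix (Fin (n + 1)) (Fin (n + 1)) (MvPolynomial (Fin (n + 1)) ℂ)) (k : ℕ)
    (f g : V n → ℂ) : V n → ℂ :=
  fun z => ∑ α : Fin k → Fin (n + 1), ∑ β : Fin k → Fin (n + 1),
    (∏ i, matAt Λ z (α i) (β i)) * partials (List.ofFn α) f z * partials (List.ofFn β) g z

/-- The product `f # g = ∑_k (1 / k!) (μ / 2)^k Λ ⋯ Λ (∂ ⋯ ∂ f) (∂ ⋯ ∂ g)` of formal series; the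
index `p = (a, k)` stands for the contribution of `μ^a f_a` to the `k`-th term. All but finitely
many contributions to a given power of `μ` vanish when `f` is a Laurent polynomial in `μ` whose
coefficients are polynomials in `Z`. -/
def sharp (Λ : Matrix (Fin (n + 1)) (Fin (n + 1)) (MvPolynomial (Fin (n + 1)) ℂ))
    (f g : ℤ → V n → ℂ) : ℤ → V n → ℂ :=
  fun m z => ∑ᶠ p : ℤ × ℕ, ((p.2.factorial : ℂ)⁻¹ * (1 / 2) ^ p.2) *
    bidiff Λ p.2 (f p.1) (g (m - p.1 - p.2)) z

/-- The formal series `1`. -/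
def oneSeries : ℤ → V n → ℂ :=
  fun m _ => if m = 0 then 1 else 0

/-- The quadratic form `A[Z] = Z A ᵗZ`. -/
def quadForm (A : Matrix (Fin (n + 1)) (Fin (n + 1)) ℂ) (z : V n) : ℂ :=
  z ⬝ᵥ (A *ᵥ z)

/-- The formal series `(1/μ) A[Z]`. -/
def quadOverMu (A : Matrix (Fin (n + 1)) (Fin (n + 1)) ℂ) : ℤ → V n → ℂ :=
  fun m z => if m = -1 then quadForm A z else 0

/-- The coefficient of `μ^m` in `exp (q / μ) = ∑_{j ≥ 0} q^j / j! · μ^{-j}`. -/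
def expOverMu (q : ℂ) (m : ℤ) : ℂ :=
  if m ≤ 0 then q ^ (-m).toNat / ((-m).toNat.factorial : ℂ) else 0

/-! ### The `#`-exponential -/

/-- `F(t) = ∑_m μ^m F_m(t, Z)` is the `#`-exponential `e_#^{t A[Z]/μ}` on the set `D` of pairs
`(t, Z)`: a formal series with finitely many positive powers of `μ`, with coefficients that are
holomorphic in `(t, Z)`, which solves `∂_t F = (1/μ) A[Z] # F` with `F(0) = 1`. -/
structure IsSharpExp (Λ : Matrix (Fin (n + 1)) (Fin (n + 1)) (MvPolynomial (Fin (n + 1)) ℂ))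
    (A : Matrix (Fin (n + 1)) (Fin (n + 1)) ℂ) (D : Set (ℂ × V n))
    (F : ℤ → ℂ → V n → ℂ) : Prop where
  analytic : ∀ m, AnalyticOnNhd ℂ (fun p : ℂ × V n => F m p.1 p.2) D
  bounded : ∃ M : ℤ, ∀ m > M, ∀ p ∈ D, F m p.1 p.2 = 0
  initial : ∀ m z, ((0 : ℂ), z) ∈ D → F m 0 z = oneSeries m z
  evolution : ∀ m t z, (t, z) ∈ D →
    HasDerivAt (fun τ => F m τ z) (sharp Λ (quadOverMu A) (fun j => F j t) m z) t

/-- `D` contains with `(t, Z)` the whole segment from `(0, Z)` to `(t, Z)`. -/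
def IsTimeStar (D : Set (ℂ × V n)) : Prop :=
  ∀ t z, (t, z) ∈ D → ∀ s ∈ Set.Icc (0 : ℝ) 1, ((s : ℂ) * t, z) ∈ D

/-! ### Functions of matrices -/

/-- `(e^M + e^{-M}) / 2`. -/
def matCosh (M : Matrix (Fin (n + 1)) (Fin (n + 1)) ℂ) : Matrix (Fin (n + 1)) (Fin (n + 1)) ℂ :=
  (1 / 2 : ℂ) • (NormedSpace.exp M + NormedSpace.exp (-M))

/-- `sin M = (e^{iM} - e^{-iM}) / (2i)`. -/
def matSin (M : Matrix (Fin (n + 1)) (Fin (n + 1)) ℂ) : Matrix (Fin (n + 1)) (Fin (n + 1)) ℂ :=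
  (1 / (2 * Complex.I) : ℂ) •
    (NormedSpace.exp (Complex.I • M) - NormedSpace.exp (-(Complex.I • M)))

/-- `cos M = (e^{iM} + e^{-iM}) / 2`. -/
def matCos (M : Matrix (Fin (n + 1)) (Fin (n + 1)) ℂ) : Matrix (Fin (n + 1)) (Fin (n + 1)) ℂ :=
  (1 / 2 : ℂ) •
    (NormedSpace.exp (Complex.I • M) + NormedSpace.exp (-(Complex.I • M)))

/-- `tan M = sin M · (cos M)⁻¹`, where `cos M` is invertible. -/
def matTan (M : Matrix (Fin (n + 1)) (Fin (n + 1)) ℂ) : Matrix (Fin (n + 1)) (Fin (n + 1)) ℂ :=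
  matSin M * (matCos M)⁻¹

/-- The entire function `sinh x / x = ∑_k x^{2k} / (2k+1)!` of a matrix. -/
def matSinhc (M : Matrix (Fin (n + 1)) (Fin (n + 1)) ℂ) : Matrix (Fin (n + 1)) (Fin (n + 1)) ℂ :=
  ∑' k : ℕ, (((2 * k + 1).factorial : ℂ)⁻¹) • M ^ (2 * k)

/-- The matrix `(L⁻¹ / i) tan (i L A)`, in the form `A · (sinh x / x)(L A) · (cosh (L A))⁻¹`, which
makes sense for singular `L` too: the factor `L⁻¹` cancels in the power series of
`(1 / i) tan (i L A) = L A - (L A)^3 / 3 + ⋯`. -/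
def lamInvTan (L A : Matrix (Fin (n + 1)) (Fin (n + 1)) ℂ) :
    Matrix (Fin (n + 1)) (Fin (n + 1)) ℂ :=
  A * matSinhc (L * A) * (matCosh (L * A))⁻¹

/-- `det ((e^{t Λ(Z) A} + e^{-t Λ(Z) A}) / 2)`. -/
def detCosh (Λ : Matrix (Fin (n + 1)) (Fin (n + 1)) (MvPolynomial (Fin (n + 1)) ℂ))
    (A : Matrix (Fin (n + 1)) (Fin (n + 1)) ℂ) (t : ℂ) (z : V n) : ℂ :=
  (matCosh (matAt Λ z * (t • A))).det

/-- The pairs `(t, Z)` for which the determinant has no zero on the segment from `(0, Z)` to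
`(t, Z)`. -/
def expDomain (Λ : Matrix (Fin (n + 1)) (Fin (n + 1)) (MvPolynomial (Fin (n + 1)) ℂ))
    (A : Matrix (Fin (n + 1)) (Fin (n + 1)) ℂ) : Set (ℂ × V n) :=
  {p | ∀ s ∈ Set.Icc (0 : ℝ) 1, detCosh Λ A ((s : ℂ) * p.1) p.2 ≠ 0}

/-- `g` is the branch of `det^{-1/2} ((e^{t Λ(Z) A} + e^{-t Λ(Z) A}) / 2)` on `expDomain Λ A` that
is continuous and equal to `1` at `t = 0`. -/
structure IsDetInvSqrt (Λ : Matrix (Fin (n + 1)) (Fin (n + 1)) (MvPolynomial (Fin (n + 1)) ℂ))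
    (A : Matrix (Fin (n + 1)) (Fin (n + 1)) ℂ) (g : ℂ → V n → ℂ) : Prop where
  continuousOn : ContinuousOn (fun p : ℂ × V n => g p.1 p.2) (expDomain Λ A)
  initial : ∀ z, g 0 z = 1
  sq_mul : ∀ t z, (t, z) ∈ expDomain Λ A → g t z ^ 2 * detCosh Λ A t z = 1

/-- The formal series `∑_m μ^m f_m` lies in `∑_k H⁰(ℂP^n, O(k)[μ, μ⁻¹]])`, with components `s k`
(Laurent series in `μ⁻¹`): the coefficient of each power of `μ` is near `Z = 0` the sum over `k` of
the corresponding coefficients of the `s k`. -/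
def HasSectionExpansion (f : ℤ → V n → ℂ) (s : (k : ℕ) → LaurentSeries (H0 n k)) : Prop :=
  ∀ j : ℤ, ∀ᶠ z in 𝓝 (0 : V n), ∀ h : z ≠ 0,
    HasSum (fun k => ((s k).coeff j).value z h) (f (-j) z)

end SymbolCalculus

end

noncomputable section

namespace SymbolCalculus

variable {n : ℕ}

/-! Write `X a b c` for `Λ^{aδ} ∂_δ Λ^{bc}`. The relation (iii) for `k = 2`, tested on linear and
quadratic `f` against linear `g`, makes `X` skew in its first two indices. Skewness of `Λ` makes it
skew in the last two, and the Jacobi rule then says `3 X = 0` (`sum_mul_pderiv_eq_zero`): the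
coefficients of `Λ` are Casimir functions. Integrated along lines, this says that `Λ` does not
change in the directions of its own row space (`matAt_add_vecMul`).

Since `A[Z]` is quadratic, `(1/μ) A[Z] #` is a second-order differential operator, and it
differentiates only along the rows of `Λ(Z)`. For it `Λ` behaves like a constant skew matrix `L`. On
a Gaussian `g exp(T[Z]/μ)` with `T` symmetric, the evolution becomes the Riccati equation `T' = A +
ALT - TLA - TLALT` together with `g' = -(1/2) tr(LALT) g`. These are solved by `T = lamInvTan L (t •
A)` and `g = det^{-1/2} cosh(tLA)` (`hasDerivAt_lamInvTan`, `hasDerivAt_det_matCosh`,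
`sharp_expSol`).

The operator does not depend on `t`, so the Taylor coefficients at `t = 0` of any solution are
iterated products. Together with the identity theorem on star-shaped time slices this gives
uniqueness. The `μ^0` coefficient of the solution is `g`, and `g^2 det cosh = 1` continues along
every domain of a solution, so no solution passes a zero of the determinant
(`IsSharpExp.eq_expSol`). The sections of `O(k)` are the homogeneous Taylor terms at `Z = 0`; the
factor `T[Z]^j` bounds their degree from below by `2j`. -/

/-! ### The coefficients of `Λ` are Casimir functions, and `Λ` is constant along its row space. -/

theorem pderiv_ite_one (a : Fin (n + 1)) (p : Prop) [Decidable p] :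
    MvPolynomial.pderiv a (if p then 1 else 0 : MvPolynomial (Fin (n + 1)) ℂ) = 0 := by
  split_ifs <;> simp

/-- The second order part of `LambdaRelation`, tested against a linear right factor. -/
theorem LambdaRelation.second_order
    {Λ : Matrix (Fin (n + 1)) (Fin (n + 1)) (MvPolynomial (Fin (n + 1)) ℂ)}
    (hrel : LambdaRelation Λ) (f : MvPolynomial (Fin (n + 1)) ℂ) (b : Fin (n + 1)) :
    ∑ α, ∑ β, ∑ γ, MvPolynomial.pderiv γ (MvPolynomial.pderiv α f * Λ α β) *
      MvPolynomial.pderiv β (Λ γ b) = 0 := by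
  have h := hrel 2 f (MvPolynomial.X b)
  -- The right-hand side differentiates `X b` twice and vanishes. On the left only those terms
  -- survive in which the first right derivative lands on the second coefficient of `Λ`.
  have hr : ∀ α β : Fin 2 → Fin (n + 1), (∏ i, Λ (α i) (β i)) *
      polyPartials (List.ofFn α) f * polyPartials (List.ofFn β) (MvPolynomial.X b) = 0 := by
    intro α β
    simp [polyPartials, List.ofFn_succ, MvPolynomial.pderiv_X, Pi.single_apply, pderiv_ite_one]
  simp only [hr, Finset.sum_const_zero] at h
  rw [← h]
  simp [arrowWord, splits, polyPartials, MvPolynomial.pderiv_X, Pi.single_apply,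
    pderiv_ite_one]

/-- This is the case `f = X a`. It removes the terms in which `∂_γ` hits `Λ` when `f` is quadratic.
-/
theorem LambdaRelation.sum_pderiv_mul_pderiv
    {Λ : Matrix (Fin (n + 1)) (Fin (n + 1)) (MvPolynomial (Fin (n + 1)) ℂ)}
    (hrel : LambdaRelation Λ) (a b : Fin (n + 1)) :
    ∑ β, ∑ γ, MvPolynomial.pderiv γ (Λ a β) * MvPolynomial.pderiv β (Λ γ b) = 0 := by
  have h := hrel.second_order (MvPolynomial.X a) b
  rw [Finset.sum_eq_single a] at h
  · simpa [MvPolynomial.pderiv_X] using h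
  · intro α _ hα
    simp [MvPolynomial.pderiv_X, hα.symm]
  · simp

/-- For `f = X a * X c` the derivative `∂_γ` hits either `Λ^{αβ}`, which contributes zero by the
linear case, or the linear factor left over from `f`. The second possibility leaves one term for
each order of `a` and `c`. -/
theorem LambdaRelation.sum_mul_pderiv_skew
    {Λ : Matrix (Fin (n + 1)) (Fin (n + 1)) (MvPolynomial (Fin (n + 1)) ℂ)}
    (hrel : LambdaRelation Λ) (a b c : Fin (n + 1)) :
    ∑ δ, Λ a δ * MvPolynomial.pderiv δ (Λ c b) +
      ∑ δ, Λ c δ * MvPolynomial.pderiv δ (Λ a b) = 0 := by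
  have h := hrel.second_order (MvPolynomial.X a * MvPolynomial.X c) b
  have ha := hrel.sum_pderiv_mul_pderiv a b
  have hc := hrel.sum_pderiv_mul_pderiv c b
  have e : ∀ α β γ : Fin (n + 1), MvPolynomial.pderiv γ
      (MvPolynomial.pderiv α (MvPolynomial.X a * MvPolynomial.X c) * Λ α β) *
      MvPolynomial.pderiv β (Λ γ b) =
      (if a = α then 1 else 0) * ((if c = γ then 1 else 0) *
          (Λ α β * MvPolynomial.pderiv β (Λ γ b))) +
        (if a = α then 1 else 0) * (MvPolynomial.X c *
          (MvPolynomial.pderiv γ (Λ α β) * MvPolynomial.pderiv β (Λ γ b))) +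
      ((if c = α then 1 else 0) * ((if a = γ then 1 else 0) *
          (Λ α β * MvPolynomial.pderiv β (Λ γ b))) +
        (if c = α then 1 else 0) * (MvPolynomial.X a *
          (MvPolynomial.pderiv γ (Λ α β) * MvPolynomial.pderiv β (Λ γ b)))) := by
    intro α β γ
    simp only [Derivation.leibniz, MvPolynomial.pderiv_X, Pi.single_apply, smul_eq_mul, map_add,
      pderiv_ite_one]
    ring
  simp only [e, Finset.sum_add_distrib, ← Finset.mul_sum] at h
  simp only [ite_mul, one_mul, zero_mul,
    Finset.sum_ite_eq, Finset.mem_univ, if_true, ha, hc, mul_zero, add_zero] at h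
  exact h

/-- The coefficients of `Λ` are Casimir functions: `Λ^{aδ} ∂_δ Λ^{bc} = 0`. -/
theorem sum_mul_pderiv_eq_zero
    {Λ : Matrix (Fin (n + 1)) (Fin (n + 1)) (MvPolynomial (Fin (n + 1)) ℂ)}
    (hskew : IsSkew Λ) (hjacobi : IsJacobi Λ) (hrel : LambdaRelation Λ) (a b c : Fin (n + 1)) :
    ∑ δ, Λ a δ * MvPolynomial.pderiv δ (Λ b c) = 0 := by
  set X : Fin (n + 1) → Fin (n + 1) → Fin (n + 1) → MvPolynomial (Fin (n + 1)) ℂ :=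
    fun a b c => ∑ δ, Λ a δ * MvPolynomial.pderiv δ (Λ b c) with hX
  have h1 : ∀ a b c, X a b c + X b a c = 0 := fun a b c => hrel.sum_mul_pderiv_skew a c b
  have h2 : ∀ a b c, X a b c + X a c b = 0 := by
    intro a b c
    simp only [hX, ← Finset.sum_add_distrib, ← mul_add, ← map_add]
    refine Finset.sum_eq_zero fun δ _ => ?_
    rw [hskew b c]; simp
  have h3 : X a b c + X b c a + X c a b = 0 := by
    simpa [hX, Finset.sum_add_distrib] using hjacobi a b c
  -- Being skew in both adjacent pairs of indices, `X` is invariant under cyclic permutations, so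
  -- the Jacobi sum is `3 X`.
  have h4 : (3 : MvPolynomial (Fin (n + 1)) ℂ) * X a b c = 0 := by
    linear_combination h3 - h2 b a c + h1 a b c - h1 a c b + h2 a b c
  exact (mul_eq_zero.mp h4).resolve_left (by norm_num)

theorem hasDerivAt_eval_line (p : MvPolynomial (Fin (n + 1)) ℂ) (z v : V n) (s : ℝ) :
    HasDerivAt (fun s : ℝ => MvPolynomial.eval (z + (s : ℂ) • v) p)
      (∑ δ, v δ * MvPolynomial.eval (z + (s : ℂ) • v) (MvPolynomial.pderiv δ p)) s := by
  induction p using MvPolynomial.induction_on with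
  | C a => simpa using hasDerivAt_const s a
  | add p q hp hq =>
    simpa [mul_add, Finset.sum_add_distrib] using hp.fun_add hq
  | mul_X p i hp =>
    have hX : HasDerivAt (fun s : ℝ => z i + (s : ℂ) * v i) (v i) s := by
      simpa using ((Complex.ofRealCLM.hasDerivAt (x := s)).mul_const (v i)).const_add (z i)
    have h := hp.fun_mul hX
    have e : (∑ δ, v δ * MvPolynomial.eval (z + (s : ℂ) • v)
        (MvPolynomial.pderiv δ (p * MvPolynomial.X i))) =
        (∑ δ, v δ * MvPolynomial.eval (z + (s : ℂ) • v) (MvPolynomial.pderiv δ p)) *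
          (z i + (s : ℂ) * v i) + MvPolynomial.eval (z + (s : ℂ) • v) p * v i := by
      have hδ : ∀ δ, v δ * MvPolynomial.eval (z + (s : ℂ) • v)
          (MvPolynomial.pderiv δ (p * MvPolynomial.X i)) =
          (v δ * MvPolynomial.eval (z + (s : ℂ) • v) (MvPolynomial.pderiv δ p)) *
            (z i + (s : ℂ) * v i) +
            if i = δ then MvPolynomial.eval (z + (s : ℂ) • v) p * v δ else 0 := by
        intro δ
        by_cases hi : i = δ
        · subst hi
          simp [Derivation.leibniz]; ring
        · simp [Derivation.leibniz, MvPolynomial.pderiv_X, hi]; ring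
      simp only [hδ, Finset.sum_add_distrib, ← Finset.sum_mul]
      simp
    rw [e]
    simpa using h

/-- `Λ` is constant along the directions in its row space. -/
theorem matAt_add_vecMul
    {Λ : Matrix (Fin (n + 1)) (Fin (n + 1)) (MvPolynomial (Fin (n + 1)) ℂ)}
    (hΛ : ∀ a b c, ∑ δ, Λ a δ * MvPolynomial.pderiv δ (Λ b c) = 0) (z w : V n) :
    matAt Λ (z + w ᵥ* matAt Λ z) = matAt Λ z := by
  set v : V n := w ᵥ* matAt Λ z with hv
  set P : ℝ → Fin (n + 1) → Fin (n + 1) → Fin (n + 1) → ℂ := fun s b c δ =>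
    MvPolynomial.eval (z + (s : ℂ) • v) (MvPolynomial.pderiv δ (Λ b c)) with hP
  set h : ℝ → Fin (n + 1) → Fin (n + 1) → ℂ := fun s b c =>
    MvPolynomial.eval (z + (s : ℂ) • v) (Λ b c) - MvPolynomial.eval z (Λ b c) with hh
  have hder : ∀ s, HasDerivAt h (fun b c => ∑ δ, v δ * P s b c δ) s := by
    intro s
    refine hasDerivAt_pi.2 fun b => hasDerivAt_pi.2 fun c => ?_
    exact (hasDerivAt_eval_line (Λ b c) z v s).sub_const _
  have hker : ∀ (s : ℝ) a b c, ∑ δ, MvPolynomial.eval (z + (s : ℂ) • v) (Λ a δ) * P s b c δ = 0 := by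
    intro s a b c
    simpa [hP] using congrArg (MvPolynomial.eval (z + ((s : ℝ) : ℂ) • v)) (hΛ a b c)
  -- The direction `v = w Λ(z)` equals `w Λ(z + s v) - w h(s)`, and the first part kills `Λ` by the
  -- Casimir property. So the derivative of `h` is linear in `h` itself, and Grönwall's inequality
  -- with `h 0 = 0` applies.
  have hval : ∀ s b c, ∑ δ, v δ * P s b c δ = -∑ a, w a * ∑ δ, h s a δ * P s b c δ := by
    intro s b c
    have e : ∀ a, ∑ δ, h s a δ * P s b c δ =
        -∑ δ, MvPolynomial.eval z (Λ a δ) * P s b c δ := by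
      intro a
      simp only [hh, sub_mul, Finset.sum_sub_distrib, hker, zero_sub]
    simp only [e, mul_neg, Finset.sum_neg_distrib, neg_neg, Finset.mul_sum]
    rw [Finset.sum_comm]
    simp only [hv, Matrix.vecMul, dotProduct, matAt, Matrix.map_apply, Finset.sum_mul, mul_assoc]
  have hPc : ∀ b c δ, Continuous fun s => P s b c δ := by
    intro b c δ
    exact (MvPolynomial.continuous_eval _).comp (by fun_prop)
  obtain ⟨C, hC⟩ := isCompact_Icc.exists_bound_of_continuousOn (s := Set.Icc (0 : ℝ) 1)
    (f := fun s => P s) (by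
      refine Continuous.continuousOn ?_
      exact continuous_pi fun b => continuous_pi fun c => continuous_pi fun δ => hPc b c δ)
  have hPb : ∀ s ∈ Set.Icc (0 : ℝ) 1, ∀ b c δ, ‖P s b c δ‖ ≤ C := fun s hs b c δ =>
    ((norm_le_pi_norm (P s b c) δ).trans ((norm_le_pi_norm (P s b) c).trans
      (norm_le_pi_norm (P s) b))).trans (hC s hs)
  have hC0 : 0 ≤ C := (norm_nonneg _).trans (hC 0 (by simp))
  have hzero := eq_zero_of_abs_deriv_le_mul_abs_self_of_eq_zero_right (f := h)
    (f' := fun s b c => ∑ δ, v δ * P s b c δ) (K := ∑ a, ‖w a‖ * ∑ _δ : Fin (n + 1), C)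
    (a := 0) (b := 1)
    (fun s _ => (hder s).continuousAt.continuousWithinAt)
    (fun s _ => (hder s).hasDerivWithinAt) (by ext b c; simp [hh]) (by
      intro s hs
      have hs' : s ∈ Set.Icc (0 : ℝ) 1 := Set.Ico_subset_Icc_self hs
      refine (pi_norm_le_iff_of_nonneg (by positivity)).2 fun b =>
        (pi_norm_le_iff_of_nonneg (by positivity)).2 fun c => ?_
      rw [hval, norm_neg, Finset.sum_mul]
      refine (norm_sum_le _ _).trans (Finset.sum_le_sum fun a _ => ?_)
      rw [norm_mul, mul_assoc, Finset.sum_mul]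
      refine mul_le_mul_of_nonneg_left ?_ (norm_nonneg _)
      refine (norm_sum_le _ _).trans (Finset.sum_le_sum fun δ _ => ?_)
      rw [norm_mul, mul_comm C]
      exact mul_le_mul ((norm_le_pi_norm (h s a) δ).trans (norm_le_pi_norm (h s) a))
        (hPb s hs' b c δ) (norm_nonneg _) (norm_nonneg _))
  have h1 := hzero 1 (by simp)
  ext b c
  have h2 := congrFun (congrFun h1 b) c
  simpa [hh, matAt, sub_eq_zero] using h2

/-! ### Exponentials, determinants and inverses of matrices: derivatives and analyticity. -/

section MatrixFunctions

variable {ι : Type*} [Fintype ι] [DecidableEq ι]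

theorem hasDerivAt_exp_smul_apply (N : Matrix ι ι ℂ) (t : ℂ) (i j : ι) :
    HasDerivAt (fun s : ℂ => NormedSpace.exp (s • N) i j)
      ((N * NormedSpace.exp (t • N)) i j) t := by
  let _ := Matrix.linftyOpNormedRing (n := ι) (α := ℂ)
  let _ := Matrix.linftyOpNormedAlgebra (n := ι) (R := ℂ) (α := ℂ)
  have h := hasDerivAt_exp_smul_const' (𝕂 := ℂ) N t
  exact hasDerivAt_pi.1 (hasDerivAt_pi.1 h i) j

theorem hasSum_matrix_exp (N : Matrix ι ι ℂ) :
    HasSum (fun k : ℕ => (k.factorial : ℂ)⁻¹ • N ^ k) (NormedSpace.exp N) := by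
  let _ := Matrix.linftyOpNormedRing (n := ι) (α := ℂ)
  let _ := Matrix.linftyOpNormedAlgebra (n := ι) (R := ℂ) (α := ℂ)
  exact NormedSpace.exp_series_hasSum_exp' (𝕂 := ℂ) N

theorem semiconjBy_matrix_exp {a x y : Matrix ι ι ℂ} (h : SemiconjBy a x y) :
    SemiconjBy a (NormedSpace.exp x) (NormedSpace.exp y) := by
  have h1 := (hasSum_matrix_exp x).mul_left a
  have h2 := (hasSum_matrix_exp y).mul_right a
  refine h1.unique ?_
  convert h2 using 2 with k
  rw [Algebra.mul_smul_comm, Algebra.smul_mul_assoc, (h.pow_right k).eq]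

theorem analyticAt_matrix_exp {E : Type*} [NormedAddCommGroup E] [NormedSpace ℂ E]
    {X : E → Matrix ι ι ℂ} {p : E} (hX : ∀ i j, AnalyticAt ℂ (fun x => X x i j) p) (i j : ι) :
    AnalyticAt ℂ (fun x => NormedSpace.exp (X x) i j) p := by
  let _ := Matrix.linftyOpNormedRing (n := ι) (α := ℂ)
  let _ := Matrix.linftyOpNormedAlgebra (n := ι) (R := ℂ) (α := ℂ)
  have h1 : AnalyticAt ℂ X p := by
    let e : (ι → ι → ℂ) →L[ℂ] Matrix ι ι ℂ := LinearMap.toContinuousLinearMap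
      { toFun := fun f => Matrix.of f, map_add' := fun _ _ => rfl, map_smul' := fun _ _ => rfl }
    have h0 : AnalyticAt ℂ (fun x => (fun i j => X x i j : ι → ι → ℂ)) p :=
      AnalyticAt.pi fun i => AnalyticAt.pi fun j => hX i j
    exact (e.analyticAt _).comp h0
  have h2 : AnalyticAt ℂ (fun x => NormedSpace.exp (X x)) p :=
    (NormedSpace.exp_analytic (𝕂 := ℂ) (X p)).comp h1
  let e : Matrix ι ι ℂ →L[ℂ] ℂ := LinearMap.toContinuousLinearMap
      { toFun := fun f => f i j, map_add' := fun _ _ => rfl, map_smul' := fun _ _ => rfl }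
  exact (e.analyticAt _).comp h2

theorem hasDerivAt_matrix_mul {ι : Type*} [Fintype ι]
    {X Y : ℂ → Matrix ι ι ℂ} {X' Y' : Matrix ι ι ℂ} {t : ℂ}
    (hX : ∀ i j, HasDerivAt (fun s => X s i j) (X' i j) t)
    (hY : ∀ i j, HasDerivAt (fun s => Y s i j) (Y' i j) t) (i j : ι) :
    HasDerivAt (fun s => (X s * Y s) i j) ((X' * Y t + X t * Y') i j) t := by
  simp only [Matrix.mul_apply, Matrix.add_apply, ← Finset.sum_add_distrib]
  exact HasDerivAt.fun_sum fun k _ => (hX i k).fun_mul (hY k j)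

theorem hasDerivAt_det_one_add_smul (N : Matrix ι ι ℂ) :
    HasDerivAt (fun s : ℂ => (1 + s • N).det) N.trace 0 := by
  have h : (fun s : ℂ => (1 + s • N).det) = fun s => 1 + N.trace * s +
      (Matrix.det (1 + (Polynomial.X : Polynomial ℂ) • N.map Polynomial.C)).divX.divX.eval s *
        s ^ 2 := funext fun s => Matrix.det_one_add_smul s N
  rw [h]
  have h1 := (((hasDerivAt_id (0 : ℂ)).const_mul N.trace).const_add 1).fun_add
    (((Matrix.det (1 + (Polynomial.X : Polynomial ℂ) • N.map Polynomial.C)).divX.divX.hasDerivAt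
      0).fun_mul ((hasDerivAt_id (0 : ℂ)).fun_pow 2))
  simpa using h1

theorem differentiable_det : Differentiable ℂ (fun Y : ι → ι → ℂ => (Matrix.of Y).det) := by
  simp only [Matrix.det_apply, Matrix.of_apply]
  fun_prop

/-- Jacobi's formula for the derivative of a determinant. -/
theorem hasDerivAt_det {X : ℂ → Matrix ι ι ℂ} {X' : Matrix ι ι ℂ} {t : ℂ}
    (hX : ∀ i j, HasDerivAt (fun s => X s i j) (X' i j) t) (hdet : IsUnit (X t).det) :
    HasDerivAt (fun s => (X s).det) ((X t).det * ((X t)⁻¹ * X').trace) t := by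
  have hφ := (differentiable_det (ι := ι) (fun i j => (1 : Matrix ι ι ℂ) i j)).hasFDerivAt
  set φ := fderiv ℂ (fun Y : ι → ι → ℂ => (Matrix.of Y).det) fun i j => (1 : Matrix ι ι ℂ) i j
  have htr : ∀ N : Matrix ι ι ℂ, φ (fun i j => N i j) = N.trace := by
    intro N
    have hc : HasDerivAt (fun s : ℂ => fun i j => (1 + s • N) i j) (fun i j => N i j) 0 := by
      refine hasDerivAt_pi.2 fun i => hasDerivAt_pi.2 fun j => ?_
      simpa using ((hasDerivAt_id (0 : ℂ)).mul_const (N i j)).const_add ((1 : Matrix ι ι ℂ) i j)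
    refine HasDerivAt.unique ?_ (hasDerivAt_det_one_add_smul N)
    exact HasFDerivAt.comp_hasDerivAt_of_eq (0 : ℂ) hφ hc (by ext; simp)
  have hc : HasDerivAt (fun s : ℂ => fun i j => ((X t)⁻¹ * X s) i j)
      (fun i j => ((X t)⁻¹ * X') i j) t := by
    refine hasDerivAt_pi.2 fun i => hasDerivAt_pi.2 fun j => ?_
    simp only [Matrix.mul_apply]
    exact HasDerivAt.fun_sum fun k _ => (hX k j).const_mul _
  have h1 := (HasFDerivAt.comp_hasDerivAt_of_eq t hφ hc
    (by ext; simp [Matrix.nonsing_inv_mul _ hdet])).const_mul (X t).det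
  rw [htr] at h1
  -- Dividing by `X t` moves the base point to the identity matrix, where the differential of the
  -- determinant is the trace.
  have e : (fun s => (X s).det) = fun s => (X t).det * ((X t)⁻¹ * X s).det := by
    ext s
    rw [← Matrix.det_mul, Matrix.mul_nonsing_inv_cancel_left _ _ hdet]
  rw [e]
  exact h1

theorem hasDerivAt_matrix_inv {X : ℂ → Matrix ι ι ℂ} {X' : Matrix ι ι ℂ} {t : ℂ}
    (hX : ∀ i j, HasDerivAt (fun s => X s i j) (X' i j) t) (hdet : IsUnit (X t).det) (i j : ι) :
    HasDerivAt (fun s => (X s)⁻¹ i j) ((-((X t)⁻¹ * X' * (X t)⁻¹)) i j) t := by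
  let _ := Matrix.linftyOpNormedRing (n := ι) (α := ℂ)
  let _ := Matrix.linftyOpNormedAlgebra (n := ι) (R := ℂ) (α := ℂ)
  have h0 : HasDerivAt X X' t := hasDerivAt_pi.2 fun i => hasDerivAt_pi.2 fun j => hX i j
  obtain ⟨u, hu⟩ := (Matrix.isUnit_iff_isUnit_det _).2 hdet
  have h1 := (hu ▸ hasFDerivAt_ringInverse (𝕜 := ℂ) u).comp_hasDerivAt t h0
  have h2 := hasDerivAt_pi.1 (hasDerivAt_pi.1 h1 i) j
  have e : (fun s => (X s)⁻¹ i j) = fun s => (Ring.inverse ∘ X) s i j := by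
    ext s
    rw [Matrix.nonsing_inv_eq_ringInverse]; rfl
  rw [e]
  refine h2.congr_deriv ?_
  have hinv : ((u⁻¹ : (Matrix ι ι ℂ)ˣ) : Matrix ι ι ℂ) = (X t)⁻¹ := by
    rw [← hu, Matrix.coe_units_inv]
  rw [← hinv]
  simp

theorem analyticAt_det {E : Type*} [NormedAddCommGroup E] [NormedSpace ℂ E]
    {X : E → Matrix ι ι ℂ} {p : E} (hX : ∀ i j, AnalyticAt ℂ (fun x => X x i j) p) :
    AnalyticAt ℂ (fun x => (X x).det) p := by
  simp only [Matrix.det_apply, Units.smul_def, zsmul_eq_mul]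
  exact Finset.univ.analyticAt_fun_sum fun σ _ => analyticAt_const.mul
    (Finset.univ.analyticAt_fun_prod fun i _ => hX _ _)

theorem analyticAt_matrix_mul {ι : Type*} [Fintype ι]
    {E : Type*} [NormedAddCommGroup E] [NormedSpace ℂ E]
    {X Y : E → Matrix ι ι ℂ} {p : E} (hX : ∀ i j, AnalyticAt ℂ (fun x => X x i j) p)
    (hY : ∀ i j, AnalyticAt ℂ (fun x => Y x i j) p) (i j : ι) :
    AnalyticAt ℂ (fun x => (X x * Y x) i j) p := by
  simp only [Matrix.mul_apply]
  exact Finset.univ.analyticAt_fun_sum fun k _ => (hX i k).mul (hY k j)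

theorem analyticAt_matrix_inv {E : Type*} [NormedAddCommGroup E] [NormedSpace ℂ E]
    {X : E → Matrix ι ι ℂ} {p : E} (hX : ∀ i j, AnalyticAt ℂ (fun x => X x i j) p)
    (hdet : (X p).det ≠ 0) (i j : ι) :
    AnalyticAt ℂ (fun x => (X x)⁻¹ i j) p := by
  simp only [Matrix.inv_def, Matrix.smul_apply, Ring.inverse_eq_inv', smul_eq_mul,
    Matrix.adjugate_apply]
  refine ((analyticAt_det hX).inv hdet).mul (analyticAt_det fun k l => ?_)
  by_cases hk : k = j
  · subst hk
    simpa using analyticAt_const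
  · simpa [Matrix.updateRow_ne hk] using hX k l

/-- The block matrix whose exponential collects `cosh M` and `sinh M / M`. -/
def oscBlock (M : Matrix ι ι ℂ) : Matrix (ι ⊕ ι) (ι ⊕ ι) ℂ :=
  Matrix.fromBlocks 0 1 (M * M) 0

/-- The square of `oscBlock M` is block diagonal with entries `M * M`. Even powers are therefore
diagonal and odd ones off-diagonal, which puts `cosh(tM)` and `t • sinhc(tM)` into the upper blocks
of the exponential. -/
theorem smul_oscBlock_pow_even (M : Matrix ι ι ℂ) (t : ℂ) (k : ℕ) :
    (t • oscBlock M) ^ (2 * k) =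
      Matrix.fromBlocks ((t • M) ^ (2 * k)) 0 0 ((t • M) ^ (2 * k)) := by
  have h : (t • oscBlock M) ^ 2 = Matrix.fromBlocks ((t • M) ^ 2) 0 0 ((t • M) ^ 2) := by
    simp [pow_two, oscBlock, Matrix.fromBlocks_smul, Matrix.fromBlocks_multiply]
  rw [pow_mul, h, pow_mul, Matrix.fromBlocks_diagonal_pow]

theorem smul_oscBlock_pow_odd (M : Matrix ι ι ℂ) (t : ℂ) (k : ℕ) :
    (t • oscBlock M) ^ (2 * k + 1) =
      Matrix.fromBlocks 0 (t • (t • M) ^ (2 * k)) (t • ((t • M) ^ (2 * k) * (M * M))) 0 := by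
  rw [pow_succ, smul_oscBlock_pow_even]
  simp [oscBlock, Matrix.fromBlocks_smul, Matrix.fromBlocks_multiply]

theorem toBlocks₁₁_exp_smul_oscBlock (M : Matrix ι ι ℂ) (t : ℂ) :
    (NormedSpace.exp (t • oscBlock M)).toBlocks₁₁ =
      (1 / 2 : ℂ) • (NormedSpace.exp (t • M) + NormedSpace.exp (-(t • M))) := by
  ext i j
  have h1 := Pi.hasSum.1 (Pi.hasSum.1 (hasSum_matrix_exp (t • oscBlock M)) (Sum.inl i)) (Sum.inl j)
  have h2 := Pi.hasSum.1 (Pi.hasSum.1 (((hasSum_matrix_exp (t • M)).add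
    (hasSum_matrix_exp (-(t • M)))).const_smul (1 / 2 : ℂ)) i) j
  refine h1.unique ?_
  convert h2 using 1
  ext k
  obtain ⟨l, rfl | rfl⟩ := Nat.even_or_odd' k
  · rw [smul_oscBlock_pow_even]
    simp only [Matrix.smul_apply, Matrix.add_apply, Matrix.fromBlocks_apply₁₁,
      (even_two_mul l).neg_pow, smul_eq_mul]
    ring
  · rw [smul_oscBlock_pow_odd]
    simp [(odd_two_mul_add_one l).neg_pow]

theorem hasSum_toBlocks₁₂_exp_smul_oscBlock (M : Matrix ι ι ℂ) (t : ℂ) :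
    HasSum (fun k : ℕ => (((2 * k + 1).factorial : ℂ)⁻¹) • t • (t • M) ^ (2 * k))
      (NormedSpace.exp (t • oscBlock M)).toBlocks₁₂ := by
  refine Pi.hasSum.2 fun i => Pi.hasSum.2 fun j => ?_
  have h1 := Pi.hasSum.1 (Pi.hasSum.1 (hasSum_matrix_exp (t • oscBlock M)) (Sum.inl i)) (Sum.inr j)
  have hinj : Function.Injective fun k : ℕ => 2 * k + 1 := fun a b h => by simpa using h
  rw [← hinj.hasSum_iff] at h1
  · convert h1 using 1
    · ext k
      simp [smul_oscBlock_pow_odd]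
    · rfl
  · intro k hk
    obtain ⟨l, rfl | rfl⟩ := Nat.even_or_odd' k
    · simp [smul_oscBlock_pow_even]
    · exact absurd ⟨l, rfl⟩ hk

theorem oscBlock_mul (M : Matrix ι ι ℂ) (X : Matrix (ι ⊕ ι) (ι ⊕ ι) ℂ) :
    oscBlock M * X =
      Matrix.fromBlocks X.toBlocks₂₁ X.toBlocks₂₂ (M * M * X.toBlocks₁₁) (M * M * X.toBlocks₁₂) := by
  conv_lhs => rw [← Matrix.fromBlocks_toBlocks X]
  simp [oscBlock, Matrix.fromBlocks_multiply]

/-- The block matrix `diag(M, M)` commutes with `oscBlock M`, hence with its exponential; compare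
blocks. -/
theorem commute_toBlocks_exp_oscBlock (M : Matrix ι ι ℂ) (t : ℂ) :
    Commute M (NormedSpace.exp (t • oscBlock M)).toBlocks₁₁ ∧
      Commute M (NormedSpace.exp (t • oscBlock M)).toBlocks₁₂ := by
  have h : Commute (Matrix.fromBlocks M 0 0 M) (t • oscBlock M) := by
    refine Commute.smul_right ?_ t
    simp [Commute, SemiconjBy, oscBlock, Matrix.fromBlocks_multiply, mul_assoc]
  have h1 := (semiconjBy_matrix_exp h).eq
  rw [← Matrix.fromBlocks_toBlocks (NormedSpace.exp (t • oscBlock M)),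
    Matrix.fromBlocks_multiply, Matrix.fromBlocks_multiply] at h1
  simp only [Matrix.fromBlocks_inj, zero_mul, mul_zero, add_zero, zero_add] at h1
  exact ⟨h1.1, h1.2.1⟩

/-- The generator commutes with its exponential. Comparing blocks expresses the lower row by the
upper one. -/
theorem toBlocks₂_exp_oscBlock (M : Matrix ι ι ℂ) (t : ℂ) :
    (NormedSpace.exp (t • oscBlock M)).toBlocks₂₁ =
        M * M * (NormedSpace.exp (t • oscBlock M)).toBlocks₁₂ ∧
      (NormedSpace.exp (t • oscBlock M)).toBlocks₂₂ =
        (NormedSpace.exp (t • oscBlock M)).toBlocks₁₁ := by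
  have h : Commute (oscBlock M) (t • oscBlock M) := (Commute.refl _).smul_right t
  have h1 := (semiconjBy_matrix_exp h).eq
  have hc := (commute_toBlocks_exp_oscBlock M t).2
  rw [← Matrix.fromBlocks_toBlocks (NormedSpace.exp (t • oscBlock M))] at h1
  simp only [oscBlock, Matrix.fromBlocks_multiply, Matrix.fromBlocks_inj, zero_mul, mul_zero,
    add_zero, zero_add, one_mul, mul_one] at h1
  refine ⟨?_, h1.2.1⟩
  rw [((hc.mul_left hc).eq)]
  exact h1.1

end MatrixFunctions

/-! ### The matrix `T = lamInvTan L (t • A)`: Riccati equation, symmetry and relation to the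
tangent. -/

section Riccati

variable (M L A : Matrix (Fin (n + 1)) (Fin (n + 1)) ℂ) (t : ℂ)

theorem matCosh_smul : matCosh (t • M) = (NormedSpace.exp (t • oscBlock M)).toBlocks₁₁ :=
  (toBlocks₁₁_exp_smul_oscBlock M t).symm

theorem hasSum_matSinhc :
    HasSum (fun k : ℕ => (((2 * k + 1).factorial : ℂ)⁻¹) • M ^ (2 * k)) (matSinhc M) := by
  have h := hasSum_toBlocks₁₂_exp_smul_oscBlock M 1
  simp only [one_smul] at h
  exact h.summable.hasSum

theorem smul_matSinhc_smul :
    t • matSinhc (t • M) = (NormedSpace.exp (t • oscBlock M)).toBlocks₁₂ := by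
  refine ((hasSum_matSinhc (t • M)).const_smul t).unique ?_
  convert hasSum_toBlocks₁₂_exp_smul_oscBlock M t using 2 with k
  rw [smul_comm]

theorem mul_matSinhc :
    M * matSinhc M = (1 / 2 : ℂ) • (NormedSpace.exp M - NormedSpace.exp (-M)) := by
  have h1 := (hasSum_matSinhc M).mul_left M
  have h2 := ((hasSum_matrix_exp M).sub (hasSum_matrix_exp (-M))).const_smul (1 / 2 : ℂ)
  have hinj : Function.Injective fun k : ℕ => 2 * k + 1 := fun a b h => by simpa using h
  rw [← hinj.hasSum_iff] at h2
  · refine h1.unique (Eq.subst (motive := fun f => HasSum f _) (funext fun k => ?_) h2)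
    simp only [Function.comp, (odd_two_mul_add_one k).neg_pow, smul_neg, sub_neg_eq_add,
      ← two_smul ℂ, smul_smul, Algebra.mul_smul_comm, ← pow_succ']
    congr 1
    ring
  · intro k hk
    obtain ⟨l, rfl | rfl⟩ := Nat.even_or_odd' k
    · simp [(even_two_mul l).neg_pow]
    · exact absurd ⟨l, rfl⟩ hk

/-- This form `T = A R C⁻¹` has blocks satisfying `R' = C` and `C' = (LA)^2 R`, which makes `T` easy
to differentiate in `t`. -/
theorem lamInvTan_smul : lamInvTan L (t • A) =
    A * (NormedSpace.exp (t • oscBlock (L * A))).toBlocks₁₂ *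
      (NormedSpace.exp (t • oscBlock (L * A))).toBlocks₁₁⁻¹ := by
  rw [lamInvTan, Matrix.mul_smul, matCosh_smul, ← smul_matSinhc_smul, Matrix.mul_smul,
    Matrix.smul_mul]

theorem hasDerivAt_osc₁₁ (i j : Fin (n + 1)) :
    HasDerivAt (fun s : ℂ => (NormedSpace.exp (s • oscBlock M)).toBlocks₁₁ i j)
      ((M * M * (NormedSpace.exp (t • oscBlock M)).toBlocks₁₂) i j) t := by
  refine (hasDerivAt_exp_smul_apply (oscBlock M) t (Sum.inl i) (Sum.inl j)).congr_deriv ?_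
  rw [← (toBlocks₂_exp_oscBlock M t).1]
  rw [oscBlock_mul]
  rfl

theorem hasDerivAt_osc₁₂ (i j : Fin (n + 1)) :
    HasDerivAt (fun s : ℂ => (NormedSpace.exp (s • oscBlock M)).toBlocks₁₂ i j)
      ((NormedSpace.exp (t • oscBlock M)).toBlocks₁₁ i j) t := by
  refine (hasDerivAt_exp_smul_apply (oscBlock M) t (Sum.inl i) (Sum.inr j)).congr_deriv ?_
  rw [← (toBlocks₂_exp_oscBlock M t).2]
  rw [oscBlock_mul]
  rfl

theorem commute_osc : Commute (NormedSpace.exp (t • oscBlock M)).toBlocks₁₁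
    (NormedSpace.exp (t • oscBlock M)).toBlocks₁₂ := by
  have hc := (commute_toBlocks_exp_oscBlock M t)
  rw [← smul_matSinhc_smul]
  refine Commute.smul_right ?_ t
  have hs := hasSum_matSinhc (t • M)
  refine ((hs.mul_left _).unique ?_)
  convert hs.mul_right _ using 2 with k
  have := ((hc.1.smul_left t).symm.pow_right (2 * k)).smul_right (((2 * k + 1).factorial : ℂ)⁻¹)
  exact this.eq

variable {M L A t}

/-- From `T = A R C⁻¹` one gets `T' = A - TLALT`. The terms `ALT` and `TLA` are equal and cancel;
they are kept because they correspond to the first-order term of the `#`-product. -/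
theorem hasDerivAt_lamInvTan (hdet : (matCosh (L * (t • A))).det ≠ 0) (i j : Fin (n + 1)) :
    HasDerivAt (fun s : ℂ => lamInvTan L (s • A) i j)
      ((A + A * L * lamInvTan L (t • A) - lamInvTan L (t • A) * L * A -
        lamInvTan L (t • A) * L * A * L * lamInvTan L (t • A)) i j) t := by
  rw [Matrix.mul_smul, matCosh_smul] at hdet
  simp only [lamInvTan_smul]
  have hu := isUnit_iff_ne_zero.2 hdet
  have h1 := hasDerivAt_matrix_mul
    (hasDerivAt_matrix_mul (X := fun _ => A) (X' := 0)
      (fun i j => hasDerivAt_const t (A i j)) (hasDerivAt_osc₁₂ (L * A) t))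
    (hasDerivAt_matrix_inv (hasDerivAt_osc₁₁ (L * A) t) hu) i j
  refine h1.congr_deriv (congrFun (congrFun ?_ i) j)
  have hc := commute_toBlocks_exp_oscBlock (L * A) t
  have hcr := commute_osc (L * A) t
  set C := (NormedSpace.exp (t • oscBlock (L * A))).toBlocks₁₁
  set R := (NormedSpace.exp (t • oscBlock (L * A))).toBlocks₁₂
  have hCC : C * C⁻¹ = 1 := Matrix.mul_nonsing_inv _ hu
  have hCC' : C⁻¹ * C = 1 := Matrix.nonsing_inv_mul _ hu
  have cinv : ∀ X, Commute X C → X * C⁻¹ = C⁻¹ * X := by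
    intro X hX
    calc X * C⁻¹ = C⁻¹ * C * X * C⁻¹ := by rw [hCC', one_mul]
      _ = C⁻¹ * X * (C * C⁻¹) := by rw [mul_assoc C⁻¹, ← hX.eq]; simp only [mul_assoc]
      _ = C⁻¹ * X := by rw [hCC, mul_one]
  have e1 := cinv (L * A) hc.1
  have e2 := cinv R hcr.symm
  have e3 := hc.2.eq
  have e4 : R * C⁻¹ * (L * A) = L * A * (R * C⁻¹) := by
    rw [mul_assoc, ← e1, ← mul_assoc, ← e3, mul_assoc]
  have l1 : A * (R * C⁻¹) * L * A = A * L * (A * (R * C⁻¹)) := by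
    simp only [mul_assoc] at e4 ⊢
    rw [e4]
  have l2 : A * R * (-(C⁻¹ * (L * A * (L * A) * R) * C⁻¹)) =
      -(A * (R * C⁻¹) * L * A * L * (A * (R * C⁻¹))) := by
    simp only [mul_assoc, mul_neg]
  rw [zero_mul, zero_add, mul_assoc A C, hCC, mul_one, l2, mul_assoc A R, l1]
  abel

/-- Jacobi's formula gives `tr(C⁻¹ (LA)^2 R)`, and cyclicity of the trace reassembles `T = A R C⁻¹`.
-/
theorem hasDerivAt_det_matCosh (hdet : (matCosh (L * (t • A))).det ≠ 0) :
    HasDerivAt (fun s : ℂ => (matCosh (L * (s • A))).det)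
      ((matCosh (L * (t • A))).det * (L * A * L * lamInvTan L (t • A)).trace) t := by
  simp only [Matrix.mul_smul, matCosh_smul, lamInvTan_smul] at hdet ⊢
  refine (hasDerivAt_det (hasDerivAt_osc₁₁ (L * A) t) (isUnit_iff_ne_zero.2 hdet)).congr_deriv ?_
  congr 1
  rw [Matrix.trace_mul_comm]
  simp only [mul_assoc]

/-- `lamInvTan L A` is symmetric if `L` is skew and `A` is symmetric. -/
theorem lamInvTan_transpose (hL : Lᵀ = -L) (hA : Aᵀ = A) (hdet : (matCosh (L * A)).det ≠ 0) :
    (lamInvTan L A)ᵀ = lamInvTan L A := by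
  have hT : (L * A)ᵀ = -(A * L) := by rw [Matrix.transpose_mul, hA, hL, Matrix.mul_neg]
  have hsemi : SemiconjBy A (L * A) (A * L) := by simp [SemiconjBy, mul_assoc]
  -- Transposition turns `LA` into `-AL`, and `A` intertwines `LA` with `AL`. The sign disappears
  -- because `cosh` and `sinh x / x` are even.
  have hC : (matCosh (L * A))ᵀ * A = A * matCosh (L * A) := by
    have h1 := (semiconjBy_matrix_exp hsemi).eq
    have h2 := (semiconjBy_matrix_exp hsemi.neg_right).eq
    simp only [matCosh, Matrix.transpose_smul, Matrix.transpose_add, ← Matrix.exp_transpose, hT,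
      Matrix.transpose_neg, neg_neg, Matrix.smul_mul, Matrix.mul_smul, add_mul, mul_add, h1, h2]
    exact congrArg _ (add_comm _ _)
  have hR : (matSinhc (L * A))ᵀ * A = A * matSinhc (L * A) := by
    have h1 := (hasSum_matSinhc (L * A)).matrix_transpose.mul_right A
    refine h1.unique ?_
    convert (hasSum_matSinhc (L * A)).mul_left A using 2 with k
    rw [Matrix.transpose_smul, Matrix.transpose_pow, hT, (even_two_mul k).neg_pow,
      Matrix.smul_mul, Matrix.mul_smul, (hsemi.pow_right (2 * k)).eq]
  have hu := isUnit_iff_ne_zero.2 hdet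
  have hu' : IsUnit (matCosh (L * A))ᵀ.det := by rwa [Matrix.det_transpose]
  have hcomm : matCosh (L * A) * matSinhc (L * A) = matSinhc (L * A) * matCosh (L * A) := by
    have h := (commute_osc (L * A) 1).eq
    rwa [← matCosh_smul, ← smul_matSinhc_smul, one_smul, one_smul] at h
  rw [lamInvTan, Matrix.transpose_mul, Matrix.transpose_mul, hA, Matrix.transpose_nonsing_inv,
    hR]
  have h1 : (matCosh (L * A))ᵀ * (A * matSinhc (L * A) * (matCosh (L * A))⁻¹) =
      A * matSinhc (L * A) := by
    rw [← mul_assoc, ← mul_assoc, hC, mul_assoc A, hcomm, ← mul_assoc,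
      Matrix.mul_nonsing_inv_cancel_right _ _ hu]
  have h2 := Matrix.nonsing_inv_mul_cancel_left (matCosh (L * A))ᵀ
    (A * matSinhc (L * A) * (matCosh (L * A))⁻¹) hu'
  rwa [h1] at h2

/-- This is `sin(ix) = i sinh x` and `cos(ix) = cosh x`. Both sides contain the same inverse, so
invertibility of `cosh` plays no role. -/
theorem mul_lamInvTan :
    L * lamInvTan L A = (1 / Complex.I) • matTan (Complex.I • (L * A)) := by
  have e : Complex.I • Complex.I • (L * A) = -(L * A) := by
    rw [smul_smul, Complex.I_mul_I, neg_one_smul]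
  rw [lamInvTan, matTan, matSin, matCos, e, neg_neg, ← mul_assoc, ← mul_assoc, mul_matSinhc,
    Matrix.smul_mul, Matrix.smul_mul, smul_smul, matCosh, add_comm (NormedSpace.exp (-(L * A))),
    ← neg_sub, Matrix.neg_mul, smul_neg, ← neg_smul]
  congr 1
  field_simp
  simp

end Riccati

/-! ### Holomorphic dependence of the determinant and of `T` on parameters. -/

section Analytic

variable {E : Type*} [NormedAddCommGroup E] [NormedSpace ℂ E] {p : E}
  {L : E → Matrix (Fin (n + 1)) (Fin (n + 1)) ℂ} {t : E → ℂ}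
  (A : Matrix (Fin (n + 1)) (Fin (n + 1)) ℂ)

theorem analyticAt_exp_oscBlock (hL : ∀ i j, AnalyticAt ℂ (fun x => L x i j) p)
    (ht : AnalyticAt ℂ t p) (i j) :
    AnalyticAt ℂ (fun x => NormedSpace.exp (t x • oscBlock (L x * A)) i j) p := by
  refine analyticAt_matrix_exp (fun i j => ht.mul ?_) i j
  have h1 := analyticAt_matrix_mul hL (Y := fun _ => A) fun i j => analyticAt_const
  rcases i with i | i <;> rcases j with j | j
  · exact analyticAt_const
  · exact analyticAt_const
  · exact analyticAt_matrix_mul h1 h1 i j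
  · exact analyticAt_const

theorem analyticAt_det_matCosh (hL : ∀ i j, AnalyticAt ℂ (fun x => L x i j) p)
    (ht : AnalyticAt ℂ t p) :
    AnalyticAt ℂ (fun x => (matCosh (L x * (t x • A))).det) p := by
  simp only [Matrix.mul_smul, matCosh_smul]
  exact analyticAt_det fun i j => analyticAt_exp_oscBlock A hL ht (Sum.inl i) (Sum.inl j)

theorem analyticAt_lamInvTan (hL : ∀ i j, AnalyticAt ℂ (fun x => L x i j) p)
    (ht : AnalyticAt ℂ t p) (hdet : (matCosh (L p * (t p • A))).det ≠ 0) (i j : Fin (n + 1)) :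
    AnalyticAt ℂ (fun x => lamInvTan (L x) (t x • A) i j) p := by
  simp only [Matrix.mul_smul, matCosh_smul] at hdet
  simp only [lamInvTan_smul]
  have h1 : ∀ i j, AnalyticAt ℂ (fun x =>
      (NormedSpace.exp (t x • oscBlock (L x * A))).toBlocks₁₁ i j) p := fun i j =>
    analyticAt_exp_oscBlock A hL ht (Sum.inl i) (Sum.inl j)
  have h2 : ∀ i j, AnalyticAt ℂ (fun x =>
      (NormedSpace.exp (t x • oscBlock (L x * A))).toBlocks₁₂ i j) p := fun i j =>
    analyticAt_exp_oscBlock A hL ht (Sum.inl i) (Sum.inr j)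
  exact analyticAt_matrix_mul
    (analyticAt_matrix_mul (X := fun _ => A) (fun i j => analyticAt_const) h2)
    (analyticAt_matrix_inv h1 hdet) i j

end Analytic

/-! ### Left `#`-multiplication by a quadratic form as a second-order operator. -/

section Partials

theorem fderiv_mulVec_apply (A : Matrix (Fin (n + 1)) (Fin (n + 1)) ℂ) (i : Fin (n + 1))
    (z v : V n) : fderiv ℂ (fun z : V n => (A *ᵥ z) i) z v = (A *ᵥ v) i := by
  let e : V n →L[ℂ] ℂ := LinearMap.toContinuousLinearMap
    ((LinearMap.proj i).comp (Matrix.mulVecLin A))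
  exact congrArg (fun f : V n →L[ℂ] ℂ => f v) (e.hasFDerivAt (x := z)).fderiv

theorem differentiable_mulVec_apply (A : Matrix (Fin (n + 1)) (Fin (n + 1)) ℂ)
    (i : Fin (n + 1)) : Differentiable ℂ (fun z : V n => (A *ᵥ z) i) := by
  simp only [Matrix.mulVec, dotProduct]
  fun_prop

theorem hasDerivAt_quadForm_line (A : Matrix (Fin (n + 1)) (Fin (n + 1)) ℂ) (hA : A.IsSymm)
    (z v : V n) : HasDerivAt (fun s : ℂ => quadForm A (z + s • v)) (2 * (v ⬝ᵥ (A *ᵥ z))) 0 := by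
  have hsymm : z ⬝ᵥ (A *ᵥ v) = v ⬝ᵥ (A *ᵥ z) := by
    rw [Matrix.dotProduct_mulVec, ← Matrix.mulVec_transpose, hA.eq, dotProduct_comm]
  have e : (fun s : ℂ => quadForm A (z + s • v)) = fun s => quadForm A z +
      s * (2 * (v ⬝ᵥ (A *ᵥ z))) + s ^ 2 * quadForm A v := by
    ext s
    simp only [quadForm, Matrix.mulVec_add, Matrix.mulVec_smul, dotProduct_add, add_dotProduct,
      smul_dotProduct, dotProduct_smul, smul_eq_mul, hsymm]
    ring
  rw [e]
  have h := (((hasDerivAt_id (0 : ℂ)).mul_const (2 * (v ⬝ᵥ (A *ᵥ z)))).const_add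
    (quadForm A z)).fun_add (((hasDerivAt_id (0 : ℂ)).fun_pow 2).mul_const (quadForm A v))
  simpa using h

theorem differentiable_quadForm (A : Matrix (Fin (n + 1)) (Fin (n + 1)) ℂ) :
    Differentiable ℂ (quadForm A) := by
  unfold quadForm
  simp only [Matrix.mulVec, dotProduct]
  fun_prop

/-- A directional derivative needs only the values on one line. This is how the constancy of `Λ`
along row-space lines enters. -/
theorem fderiv_eq_of_hasDerivAt_line {f : V n → ℂ} {z v : V n} {c : ℂ}
    (hf : DifferentiableAt ℂ f z) (h : HasDerivAt (fun s : ℂ => f (z + s • v)) c 0) :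
    fderiv ℂ f z v = c :=
  (hf.hasFDerivAt.hasLineDerivAt v).unique h

theorem partialD_quadForm (A : Matrix (Fin (n + 1)) (Fin (n + 1)) ℂ) (hA : A.IsSymm)
    (α : Fin (n + 1)) : partialD α (quadForm A) = fun z => 2 * (A *ᵥ z) α := by
  ext z
  have h := fderiv_eq_of_hasDerivAt_line (differentiable_quadForm A z)
    (hasDerivAt_quadForm_line A hA z (Pi.single α 1))
  rwa [single_dotProduct, one_mul] at h

theorem partialD_partialD_quadForm (A : Matrix (Fin (n + 1)) (Fin (n + 1)) ℂ) (hA : A.IsSymm)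
    (α β : Fin (n + 1)) : partialD β (partialD α (quadForm A)) = fun _ => 2 * A α β := by
  ext z
  rw [partialD_quadForm A hA, partialD, fderiv_const_mul (differentiable_mulVec_apply A α z)]
  simp [fderiv_mulVec_apply]

theorem partials_zero (l : List (Fin (n + 1))) : partials l (fun _ => (0 : ℂ)) = fun _ => 0 := by
  induction l with
  | nil => rfl
  | cons a l ih =>
    change partialD a (partials l _) = _
    rw [ih]
    ext z
    simp [partialD]

theorem partials_quadForm_of_three_le (A : Matrix (Fin (n + 1)) (Fin (n + 1)) ℂ) (hA : A.IsSymm)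
    (l : List (Fin (n + 1))) (hl : 3 ≤ l.length) : partials l (quadForm A) = fun _ => 0 := by
  induction l with
  | nil => simp at hl
  | cons a l ih =>
    change partialD a (partials l _) = _
    rcases Nat.lt_or_ge l.length 3 with h | h
    · obtain ⟨b, c, rfl⟩ := List.length_eq_two.1 (show l.length = 2 by simp at hl; omega)
      change partialD a (partialD b (partialD c (quadForm A))) = _
      rw [partialD_partialD_quadForm A hA]
      ext z
      simp [partialD]
    · rw [ih h]
      ext z
      simp [partialD]

theorem partials_congr {O : Set (V n)} (hO : IsOpen O) {f g : V n → ℂ} (hfg : Set.EqOn f g O)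
    (l : List (Fin (n + 1))) : Set.EqOn (partials l f) (partials l g) O := by
  induction l with
  | nil => exact hfg
  | cons a l ih =>
    intro z hz
    exact congrArg (fun L : V n →L[ℂ] ℂ => L (Pi.single a 1))
      ((ih.eventuallyEq_of_mem (hO.mem_nhds hz)).fderiv_eq (𝕜 := ℂ))

theorem sharp_congr (Λ : Matrix (Fin (n + 1)) (Fin (n + 1)) (MvPolynomial (Fin (n + 1)) ℂ))
    (q : ℤ → V n → ℂ) {O : Set (V n)} (hO : IsOpen O) {f g : ℤ → V n → ℂ}
    (hfg : ∀ j, Set.EqOn (f j) (g j) O) (m : ℤ) :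
    Set.EqOn (sharp Λ q f m) (sharp Λ q g m) O := by
  intro z hz
  refine finsum_congr fun p => ?_
  unfold bidiff
  simp only [partials_congr hO (hfg _) _ hz]

theorem iterate_sharp_congr
    (Λ : Matrix (Fin (n + 1)) (Fin (n + 1)) (MvPolynomial (Fin (n + 1)) ℂ))
    (q : ℤ → V n → ℂ) {O : Set (V n)} (hO : IsOpen O) (N : ℕ) {f g : ℤ → V n → ℂ}
    (hfg : ∀ j, Set.EqOn (f j) (g j) O) (m : ℤ) :
    Set.EqOn ((sharp Λ q)^[N] f m) ((sharp Λ q)^[N] g m) O := by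
  induction N generalizing f g with
  | zero => exact hfg m
  | succ N ih =>
    simp only [Function.iterate_succ_apply]
    exact ih fun j => sharp_congr Λ q hO hfg j

section Terms

variable (Λ : Matrix (Fin (n + 1)) (Fin (n + 1)) (MvPolynomial (Fin (n + 1)) ℂ))
  (A : Matrix (Fin (n + 1)) (Fin (n + 1)) ℂ)

theorem bidiff_zero (f g : V n → ℂ) (z : V n) : bidiff Λ 0 f g z = f z * g z := by
  simp [bidiff, partials]

theorem bidiff_one (f g : V n → ℂ) (z : V n) : bidiff Λ 1 f g z =
    ∑ α, ∑ β, matAt Λ z α β * partialD α f z * partialD β g z := by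
  unfold bidiff
  rw [← (Equiv.funUnique (Fin 1) (Fin (n + 1))).symm.sum_comp]
  refine Finset.sum_congr rfl fun α _ => ?_
  rw [← (Equiv.funUnique (Fin 1) (Fin (n + 1))).symm.sum_comp]
  refine Finset.sum_congr rfl fun β _ => ?_
  simp [partials]

theorem bidiff_two (f g : V n → ℂ) (z : V n) : bidiff Λ 2 f g z =
    ∑ α, ∑ α', ∑ β, ∑ β', matAt Λ z α β * matAt Λ z α' β' *
      partialD α (partialD α' f) z * partialD β (partialD β' g) z := by
  unfold bidiff
  rw [← (finTwoArrowEquiv (Fin (n + 1))).symm.sum_comp, Fintype.sum_prod_type]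
  refine Finset.sum_congr rfl fun α _ => Finset.sum_congr rfl fun α' _ => ?_
  rw [← (finTwoArrowEquiv (Fin (n + 1))).symm.sum_comp, Fintype.sum_prod_type]
  refine Finset.sum_congr rfl fun β _ => Finset.sum_congr rfl fun β' _ => ?_
  simp [partials]

theorem bidiff_zero_left (k : ℕ) (g : V n → ℂ) (z : V n) :
    bidiff Λ k (fun _ => 0) g z = 0 := by
  unfold bidiff
  refine Finset.sum_eq_zero fun α _ => Finset.sum_eq_zero fun β _ => ?_
  rw [partials_zero]
  simp

theorem bidiff_quadForm_of_three_le (hA : A.IsSymm) {k : ℕ} (hk : 3 ≤ k) (g : V n → ℂ)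
    (z : V n) : bidiff Λ k (quadForm A) g z = 0 := by
  unfold bidiff
  refine Finset.sum_eq_zero fun α _ => Finset.sum_eq_zero fun β _ => ?_
  rw [partials_quadForm_of_three_le A hA _ (by simpa using hk)]
  simp

/-- The left factor lives at `μ^{-1}` and has degree two in `Z`, so only `k = 0, 1, 2` remain. The
constants are `(1/k!) (1/2)^k`. -/
theorem sharp_quadOverMu_eq_bidiff (hA : A.IsSymm) (f : ℤ → V n → ℂ) (m : ℤ) (z : V n) :
    sharp Λ (quadOverMu A) f m z = bidiff Λ 0 (quadForm A) (f (m + 1)) z +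
      (1 / 2) * bidiff Λ 1 (quadForm A) (f m) z +
      (1 / 8) * bidiff Λ 2 (quadForm A) (f (m - 1)) z := by
  have hq : quadOverMu A (-1) = quadForm A := by ext z; simp [quadOverMu]
  have hq' : ∀ j : ℤ, j ≠ -1 → quadOverMu A j = fun _ => 0 := by
    intro j hj; ext z; simp [quadOverMu, hj]
  have hsupp : (Function.support fun p : ℤ × ℕ => ((p.2.factorial : ℂ)⁻¹ * (1 / 2) ^ p.2) *
      bidiff Λ p.2 (quadOverMu A p.1) (f (m - p.1 - p.2)) z) ⊆
      (({(-1, 0), (-1, 1), (-1, 2)} : Finset (ℤ × ℕ)) : Set (ℤ × ℕ)) := by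
    rintro ⟨j, k⟩ hp
    by_contra hne
    refine hp (mul_eq_zero_of_right _ ?_)
    by_cases hj : j = -1
    · subst hj
      have hk : 3 ≤ k := by
        by_contra hk
        interval_cases k <;> simp at hne
      rw [hq]
      exact bidiff_quadForm_of_three_le Λ A hA hk _ _
    · rw [hq' j hj]
      exact bidiff_zero_left Λ _ _ _
  rw [sharp, finsum_eq_sum_of_support_subset _ hsupp, Finset.sum_insert (by simp),
    Finset.sum_insert (by simp), Finset.sum_singleton, hq, ← add_assoc]
  have i0 : m - -1 - ((0 : ℕ) : ℤ) = m + 1 := by push_cast; ring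
  have i1 : m - -1 - ((1 : ℕ) : ℤ) = m := by push_cast; ring
  have i2 : m - -1 - ((2 : ℕ) : ℤ) = m - 1 := by push_cast; ring
  rw [i0, i1, i2]
  norm_num [Nat.factorial]

/-- Left multiplication by `A[Z] / μ` is a differential operator of second order. -/
theorem sharp_quadOverMu (hA : A.IsSymm) (f : ℤ → V n → ℂ) (m : ℤ) (z : V n) :
    sharp Λ (quadOverMu A) f m z = quadForm A z * f (m + 1) z +
      ∑ α, ∑ β, (matAt Λ z α β * (A *ᵥ z) α) * partialD β (f m) z +
      ∑ α, ∑ α', ∑ β, ∑ β', (1 / 4 * (matAt Λ z α β * matAt Λ z α' β') * A α α') *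
        partialD β (partialD β' (f (m - 1))) z := by
  rw [sharp_quadOverMu_eq_bidiff Λ A hA, bidiff_zero, bidiff_one, bidiff_two]
  have h1 : (1 / 2 : ℂ) * ∑ α, ∑ β, matAt Λ z α β * partialD α (quadForm A) z *
      partialD β (f m) z =
      ∑ α, ∑ β, (matAt Λ z α β * (A *ᵥ z) α) * partialD β (f m) z := by
    rw [Finset.mul_sum]
    refine Finset.sum_congr rfl fun α _ => ?_
    rw [Finset.mul_sum]
    refine Finset.sum_congr rfl fun β _ => ?_
    rw [partialD_quadForm A hA]
    ring
  have h2 : ∀ α α' β β', (1 / 8 : ℂ) * (matAt Λ z α β * matAt Λ z α' β' *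
      partialD α (partialD α' (quadForm A)) z * partialD β (partialD β' (f (m - 1))) z) =
      (1 / 4 * (matAt Λ z α β * matAt Λ z α' β') * A α α') *
        partialD β (partialD β' (f (m - 1))) z := by
    intro α α' β β'
    rw [partialD_partialD_quadForm A hA, hA.apply α α']
    ring
  rw [h1, add_right_inj, Finset.mul_sum]
  refine Finset.sum_congr rfl fun α _ => ?_
  rw [Finset.mul_sum]
  refine Finset.sum_congr rfl fun α' _ => ?_
  rw [Finset.mul_sum]
  refine Finset.sum_congr rfl fun β _ => ?_
  rw [Finset.mul_sum]
  exact Finset.sum_congr rfl fun β' _ => h2 α α' β β'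

end Terms

end Partials

/-! ### The evolution operator in the variables `(t, Z)` and Taylor coefficients in `t`. -/

section Evolution

/-- The derivative in the direction `v`. -/
def dirDeriv {E : Type*} [NormedAddCommGroup E] [NormedSpace ℂ E] (v : E) (u : E → ℂ) : E → ℂ :=
  fun p => fderiv ℂ u p v

section DirDeriv

variable {E : Type*} [NormedAddCommGroup E] [NormedSpace ℂ E] {D : Set E} {u u' : E → ℂ}

theorem analyticOnNhd_dirDeriv (hu : AnalyticOnNhd ℂ u D) (v : E) :
    AnalyticOnNhd ℂ (dirDeriv v u) D := fun p hp =>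
  ((ContinuousLinearMap.apply ℂ ℂ v).analyticAt _).comp (hu.fderiv p hp)

theorem dirDeriv_congr (hD : IsOpen D) (h : Set.EqOn u u' D) (v : E) :
    Set.EqOn (dirDeriv v u) (dirDeriv v u') D := fun _ hp =>
  congrArg (fun L : E →L[ℂ] ℂ => L v)
    ((h.eventuallyEq_of_mem (hD.mem_nhds hp)).fderiv_eq (𝕜 := ℂ))

theorem dirDeriv_comm (hu : AnalyticOnNhd ℂ u D) (v w : E) {p : E} (hp : p ∈ D) :
    dirDeriv v (dirDeriv w u) p = dirDeriv w (dirDeriv v u) p := by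
  have hd : DifferentiableAt ℂ (fderiv ℂ u) p := (hu.fderiv p hp).differentiableAt
  have h : ∀ v w : E, dirDeriv v (dirDeriv w u) p = fderiv ℂ (fderiv ℂ u) p v w := by
    intro v w
    have := ((ContinuousLinearMap.apply ℂ ℂ w).hasFDerivAt.comp p hd.hasFDerivAt).fderiv
    exact congrArg (fun L : E →L[ℂ] ℂ => L v) this
  rw [h, h]
  exact ((hu p hp).contDiffAt (n := ⊤)).isSymmSndFDerivAt (by simp) v w

theorem dirDeriv_add {p : E} (hu : DifferentiableAt ℂ u p) (hu' : DifferentiableAt ℂ u' p) (v : E) :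
    dirDeriv v (fun p => u p + u' p) p = dirDeriv v u p + dirDeriv v u' p := by
  simp [dirDeriv, fderiv_fun_add hu hu']

theorem dirDeriv_mul_of_eq_zero {c : E → ℂ} {p : E} (hc : DifferentiableAt ℂ c p)
    (hu : DifferentiableAt ℂ u p) {v : E} (hv : dirDeriv v c p = 0) :
    dirDeriv v (fun p => c p * u p) p = c p * dirDeriv v u p := by
  unfold dirDeriv at *
  simp [fderiv_fun_mul hc hu, hv]

theorem dirDeriv_sum {κ : Type*} (s : Finset κ) {u : κ → E → ℂ} {p : E}
    (hu : ∀ k ∈ s, DifferentiableAt ℂ (u k) p) (v : E) :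
    dirDeriv v (fun p => ∑ k ∈ s, u k p) p = ∑ k ∈ s, dirDeriv v (u k) p := by
  simp [dirDeriv, fderiv_fun_sum hu]

end DirDeriv

variable (Λ : Matrix (Fin (n + 1)) (Fin (n + 1)) (MvPolynomial (Fin (n + 1)) ℂ))
  (A : Matrix (Fin (n + 1)) (Fin (n + 1)) ℂ)

/-- The direction of the coordinate `z_α` in `ℂ × ℂ^{n+1}`. -/
def spaceDir (α : Fin (n + 1)) : ℂ × V n := (0, Pi.single α 1)

/-- Left `#`-multiplication by `A[Z] / μ` as an operator on families of functions of `(t, Z)`. -/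
def evol (U : ℤ → ℂ × V n → ℂ) (m : ℤ) (p : ℂ × V n) : ℂ :=
  quadForm A p.2 * U (m + 1) p +
    ∑ α, ∑ β, (matAt Λ p.2 α β * (A *ᵥ p.2) α) * dirDeriv (spaceDir β) (U m) p +
    ∑ α, ∑ α', ∑ β, ∑ β', (1 / 4 * (matAt Λ p.2 α β * matAt Λ p.2 α' β') * A α α') *
      dirDeriv (spaceDir β) (dirDeriv (spaceDir β') (U (m - 1))) p

theorem analyticAt_matAt (α β : Fin (n + 1)) (z : V n) :
    AnalyticAt ℂ (fun z => matAt Λ z α β) z := by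
  have h := AnalyticOnNhd.eval_mvPolynomial (𝕜 := ℂ) (Λ α β) z (Set.mem_univ z)
  exact h

theorem analyticAt_snd_comp {f : V n → ℂ} (p : ℂ × V n) (hf : AnalyticAt ℂ f p.2) :
    AnalyticAt ℂ (fun p : ℂ × V n => f p.2) p :=
  hf.comp analyticAt_snd

theorem dirDeriv_time_snd {f : V n → ℂ} (p : ℂ × V n) (hf : DifferentiableAt ℂ f p.2) :
    dirDeriv (1, 0) (fun p : ℂ × V n => f p.2) p = 0 := by
  have := (hf.hasFDerivAt.comp p hasFDerivAt_snd).fderiv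
  have h := congrArg (fun L : (ℂ × V n) →L[ℂ] ℂ => L (1, 0)) this
  refine h.trans ?_
  simp

theorem analyticAt_mulVec_apply (i : Fin (n + 1)) (z : V n) :
    AnalyticAt ℂ (fun z : V n => (A *ᵥ z) i) z := by
  simp only [Matrix.mulVec, dotProduct]
  refine Finset.univ.analyticAt_fun_sum fun k _ => analyticAt_const.mul ?_
  exact (ContinuousLinearMap.proj (R := ℂ) (φ := fun _ : Fin (n + 1) => ℂ) k).analyticAt z

theorem analyticAt_quadForm (z : V n) : AnalyticAt ℂ (quadForm A) z := by
  unfold quadForm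
  simp only [dotProduct]
  refine Finset.univ.analyticAt_fun_sum fun k _ => AnalyticAt.mul ?_
    (analyticAt_mulVec_apply A k z)
  exact (ContinuousLinearMap.proj (R := ℂ) (φ := fun _ : Fin (n + 1) => ℂ) k).analyticAt z

variable {D : Set (ℂ × V n)} {U U' : ℤ → ℂ × V n → ℂ}

theorem evol_congr (hD : IsOpen D) (h : ∀ m, Set.EqOn (U m) (U' m) D) (m : ℤ) :
    Set.EqOn (evol Λ A U m) (evol Λ A U' m) D := by
  intro p hp
  simp only [evol, h _ hp, dirDeriv_congr hD (h _) _ hp,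
    dirDeriv_congr hD (dirDeriv_congr hD (h _) _) _ hp]

theorem analyticOnNhd_evol (hU : ∀ m, AnalyticOnNhd ℂ (U m) D) (m : ℤ) :
    AnalyticOnNhd ℂ (evol Λ A U m) D := by
  intro p hp
  have hL : ∀ α β, AnalyticAt ℂ (fun p : ℂ × V n => matAt Λ p.2 α β) p := fun α β =>
    analyticAt_snd_comp p (analyticAt_matAt Λ α β p.2)
  have hAz : ∀ α, AnalyticAt ℂ (fun p : ℂ × V n => (A *ᵥ p.2) α) p := fun α =>
    analyticAt_snd_comp p (analyticAt_mulVec_apply A α p.2)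
  refine (((analyticAt_snd_comp p (analyticAt_quadForm A p.2)).mul (hU _ p hp)).add ?_).add ?_
  · exact Finset.univ.analyticAt_fun_sum fun α _ => Finset.univ.analyticAt_fun_sum fun β _ =>
      ((hL α β).mul (hAz α)).mul (analyticOnNhd_dirDeriv (hU m) _ p hp)
  · exact Finset.univ.analyticAt_fun_sum fun α _ => Finset.univ.analyticAt_fun_sum fun α' _ =>
      Finset.univ.analyticAt_fun_sum fun β _ => Finset.univ.analyticAt_fun_sum fun β' _ =>
      ((analyticAt_const.mul ((hL α β).mul (hL α' β'))).mul analyticAt_const).mul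
        (analyticOnNhd_dirDeriv (analyticOnNhd_dirDeriv (hU _) _) _ p hp)

/-- The coefficients of `evol` do not depend on `t`, and partial derivatives of holomorphic
functions commute. -/
theorem dirDeriv_time_evol (hD : IsOpen D) (hU : ∀ m, AnalyticOnNhd ℂ (U m) D) (m : ℤ) {p : ℂ × V n}
    (hp : p ∈ D) : dirDeriv (1, 0) (evol Λ A U m) p =
      evol Λ A (fun m => dirDeriv (1, 0) (U m)) m p := by
  have hL : ∀ α β, AnalyticAt ℂ (fun z => matAt Λ z α β) p.2 := fun α β =>
    analyticAt_matAt Λ α β p.2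
  have hAz : ∀ α, AnalyticAt ℂ (fun z => (A *ᵥ z) α) p.2 := fun α =>
    analyticAt_mulVec_apply A α p.2
  have key : ∀ (c : V n → ℂ) (u : ℂ × V n → ℂ), AnalyticAt ℂ c p.2 → AnalyticAt ℂ u p →
      DifferentiableAt ℂ (fun p : ℂ × V n => c p.2 * u p) p ∧
      dirDeriv (1, 0) (fun p : ℂ × V n => c p.2 * u p) p = c p.2 * dirDeriv (1, 0) u p :=
    fun c u hc hu => ⟨((analyticAt_snd_comp p hc).mul hu).differentiableAt,
      dirDeriv_mul_of_eq_zero (analyticAt_snd_comp p hc).differentiableAt hu.differentiableAt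
        (dirDeriv_time_snd p hc.differentiableAt)⟩
  have k0 := key (quadForm A) (U (m + 1)) (analyticAt_quadForm A p.2) (hU _ p hp)
  have k1 := fun α β => key (fun z => matAt Λ z α β * (A *ᵥ z) α)
    (dirDeriv (spaceDir β) (U m)) ((hL α β).mul (hAz α)) (analyticOnNhd_dirDeriv (hU m) _ p hp)
  have k2 := fun α α' β β' => key
    (fun z => 1 / 4 * (matAt Λ z α β * matAt Λ z α' β') * A α α')
    (dirDeriv (spaceDir β) (dirDeriv (spaceDir β') (U (m - 1))))
    ((analyticAt_const.mul ((hL α β).mul (hL α' β'))).mul analyticAt_const)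
    (analyticOnNhd_dirDeriv (analyticOnNhd_dirDeriv (hU _) _) _ p hp)
  have d1 : ∀ α, DifferentiableAt ℂ (fun p : ℂ × V n => ∑ β,
      (matAt Λ p.2 α β * (A *ᵥ p.2) α) * dirDeriv (spaceDir β) (U m) p) p := fun α =>
    DifferentiableAt.fun_sum fun β _ => (k1 α β).1
  have d2 : ∀ α α' β, DifferentiableAt ℂ (fun p : ℂ × V n => ∑ β',
      (1 / 4 * (matAt Λ p.2 α β * matAt Λ p.2 α' β') * A α α') *
        dirDeriv (spaceDir β) (dirDeriv (spaceDir β') (U (m - 1))) p) p := fun α α' β =>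
    DifferentiableAt.fun_sum fun β' _ => (k2 α α' β β').1
  have d3 := fun α α' => DifferentiableAt.fun_sum (u := Finset.univ) fun β _ => d2 α α' β
  have d4 := fun α => DifferentiableAt.fun_sum (u := Finset.univ) fun α' _ => d3 α α'
  have d5 := DifferentiableAt.fun_sum (u := Finset.univ) fun α _ => d4 α
  have d6 := DifferentiableAt.fun_sum (u := Finset.univ) fun α _ => d1 α
  have hc1 : ∀ β, dirDeriv (1, 0) (dirDeriv (spaceDir β) (U m)) p =
      dirDeriv (spaceDir β) (dirDeriv (1, 0) (U m)) p := fun β => dirDeriv_comm (hU m) _ _ hp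
  have hc2 : ∀ β β', dirDeriv (1, 0) (dirDeriv (spaceDir β) (dirDeriv (spaceDir β') (U (m - 1))))
      p = dirDeriv (spaceDir β) (dirDeriv (spaceDir β') (dirDeriv (1, 0) (U (m - 1)))) p := by
    intro β β'
    rw [dirDeriv_comm (analyticOnNhd_dirDeriv (hU _) _) _ _ hp]
    exact dirDeriv_congr hD (fun q hq => dirDeriv_comm (hU _) _ _ hq) _ hp
  unfold evol
  rw [dirDeriv_add (k0.1.fun_add d6) d5, dirDeriv_add k0.1 d6, k0.2]
  simp only [dirDeriv_sum _ (fun α _ => d1 α), dirDeriv_sum _ (fun β _ => (k1 _ β).1), (k1 _ _).2,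
    dirDeriv_sum _ (fun α _ => d4 α), dirDeriv_sum _ (fun α _ => d3 _ α),
    dirDeriv_sum _ (fun α _ => d2 _ _ α), dirDeriv_sum _ (fun α _ => (k2 _ _ _ α).1),
    (k2 _ _ _ _).2, hc1, hc2]

theorem hasDerivAt_time {u : ℂ × V n → ℂ} {p : ℂ × V n} (hu : DifferentiableAt ℂ u p) :
    HasDerivAt (fun τ => u (τ, p.2)) (dirDeriv (1, 0) u p) p.1 := by
  have h : HasDerivAt (fun τ : ℂ => (τ, p.2)) ((1 : ℂ), (0 : V n)) p.1 :=
    (hasDerivAt_id p.1).prodMk (hasDerivAt_const p.1 p.2)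
  exact HasFDerivAt.comp_hasDerivAt p.1 (f := fun τ : ℂ => (τ, p.2)) (l := u) hu.hasFDerivAt h

theorem isOpen_timeSlice (hD : IsOpen D) (t : ℂ) : IsOpen {z : V n | (t, z) ∈ D} :=
  hD.preimage (by fun_prop)

theorem isOpen_spaceSlice (hD : IsOpen D) (z : V n) : IsOpen {t : ℂ | (t, z) ∈ D} :=
  hD.preimage (by fun_prop)

theorem partialD_slice {u : ℂ × V n → ℂ} {p : ℂ × V n} (hu : DifferentiableAt ℂ u p)
    (α : Fin (n + 1)) : partialD α (fun z => u (p.1, z)) p.2 = dirDeriv (spaceDir α) u p := by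
  have h : HasFDerivAt (fun z : V n => (p.1, z)) (ContinuousLinearMap.inr ℂ ℂ (V n)) p.2 :=
    hasFDerivAt_prodMk_right p.1 p.2
  have := (HasFDerivAt.comp p.2 (f := fun z : V n => (p.1, z)) (g := u) hu.hasFDerivAt h).fderiv
  exact congrArg (fun L : V n →L[ℂ] ℂ => L (Pi.single α 1)) this

/-- `sharp` differentiates at fixed `t`, whereas `evol` acts on functions of `(t, Z)`; the joint
picture allows `∂_t` and `∂_Z` to be exchanged. -/
theorem sharp_slice (hD : IsOpen D) (hA : A.IsSymm) (hU : ∀ m, AnalyticOnNhd ℂ (U m) D) (m : ℤ)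
    {t : ℂ} {z : V n} (hz : (t, z) ∈ D) :
    sharp Λ (quadOverMu A) (fun j z => U j (t, z)) m z = evol Λ A U m (t, z) := by
  have h1 : ∀ (u : ℂ × V n → ℂ), AnalyticOnNhd ℂ u D → ∀ β, Set.EqOn
      (partialD β (fun z => u (t, z))) (fun z => dirDeriv (spaceDir β) u (t, z))
      {z : V n | (t, z) ∈ D} := fun u hu β z hz =>
    partialD_slice (p := (t, z)) (hu (t, z) hz).differentiableAt β
  have h2 : ∀ β β', partialD β (partialD β' (fun z => U (m - 1) (t, z))) z =
      dirDeriv (spaceDir β) (dirDeriv (spaceDir β') (U (m - 1))) (t, z) := by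
    intro β β'
    refine Eq.trans ?_ (h1 _ (analyticOnNhd_dirDeriv (hU (m - 1)) (spaceDir β')) β hz)
    exact partials_congr (isOpen_timeSlice hD t) (h1 _ (hU (m - 1)) β') [β] hz
  simp only [sharp_quadOverMu Λ A hA, evol, h2, h1 _ (hU m) _ hz]

theorem iterate_sharp_slice (hD : IsOpen D) (hA : A.IsSymm)
    (hU : ∀ m, AnalyticOnNhd ℂ (U m) D) (N : ℕ) (m : ℤ) {t : ℂ} {z : V n} (hz : (t, z) ∈ D) :
    (sharp Λ (quadOverMu A))^[N] (fun j z => U j (t, z)) m z = (evol Λ A)^[N] U m (t, z) := by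
  induction N generalizing U with
  | zero => rfl
  | succ N ih =>
    simp only [Function.iterate_succ_apply]
    rw [← ih (analyticOnNhd_evol Λ A hU)]
    exact iterate_sharp_congr Λ _ (isOpen_timeSlice hD t) N
      (fun j z hz => sharp_slice Λ A hD hA hU j hz) m hz

/-- If `U` solves `∂_t U = evol U`, then so does `evol U`, because `evol` commutes with `∂_t`. Hence
each time derivative costs one application of `evol`. -/
theorem iteratedDeriv_time (hD : IsOpen D) (hU : ∀ m, AnalyticOnNhd ℂ (U m) D)
    (hevol : ∀ m, Set.EqOn (dirDeriv (1, 0) (U m)) (evol Λ A U m) D) (N : ℕ) (m : ℤ)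
    {t : ℂ} {z : V n} (hz : (t, z) ∈ D) :
    iteratedDeriv N (fun τ => U m (τ, z)) t = (evol Λ A)^[N] U m (t, z) := by
  induction N generalizing U with
  | zero => simp
  | succ N ih =>
    have h1 : deriv (fun τ => U m (τ, z)) =ᶠ[𝓝 t] fun τ => evol Λ A U m (τ, z) := by
      filter_upwards [(isOpen_spaceSlice hD z).mem_nhds hz] with τ hτ
      rw [(hasDerivAt_time (p := (τ, z)) (hU m _ hτ).differentiableAt).deriv, hevol m hτ]
    rw [iteratedDeriv_succ', h1.iteratedDeriv_eq, Function.iterate_succ_apply]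
    refine ih (analyticOnNhd_evol Λ A hU) fun m p hp => ?_
    rw [dirDeriv_time_evol Λ A hD hU m hp]
    exact evol_congr Λ A hD hevol m hp

/-- The Taylor coefficients of a `#`-exponential are those of the exponential series. -/
theorem IsSharpExp.iteratedDeriv_zero (hA : A.IsSymm) {F : ℤ → ℂ → V n → ℂ} (hD : IsOpen D)
    (hF : IsSharpExp Λ A D F) (m : ℤ) {z : V n} (hz : ((0 : ℂ), z) ∈ D) (N : ℕ) :
    iteratedDeriv N (fun t => F m t z) 0 = ((sharp Λ (quadOverMu A))^[N] oneSeries) m z := by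
  have hev : ∀ m, Set.EqOn (dirDeriv (1, 0) (fun p : ℂ × V n => F m p.1 p.2))
      (evol Λ A (fun m p => F m p.1 p.2) m) D := by
    rintro m ⟨t, z⟩ hp
    rw [← sharp_slice Λ A hD hA hF.analytic m hp]
    exact (hasDerivAt_time (p := (t, z)) (hF.analytic m _ hp).differentiableAt).unique
      (hF.evolution m t z hp)
  rw [iteratedDeriv_time Λ A (U := fun m p => F m p.1 p.2) hD hF.analytic hev N m hz,
    ← iterate_sharp_slice Λ A hD hA hF.analytic N m hz]
  exact iterate_sharp_congr Λ _ (isOpen_timeSlice hD 0) N (fun j z hz => hF.initial j z hz) m hz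

end Evolution

/-! ### The branch of `det^{-1/2}` along segments from the origin. -/

section Branch

variable (L A : Matrix (Fin (n + 1)) (Fin (n + 1)) ℂ)

/-- `det cosh (t L A)`. -/
def detCoshAt (t : ℂ) : ℂ := (matCosh (L * (t • A))).det

theorem analyticAt_detCoshAt (t : ℂ) : AnalyticAt ℂ (detCoshAt L A) t :=
  analyticAt_det_matCosh A (L := fun _ => L) (fun _ _ => analyticAt_const) analyticAt_id

@[simp]
theorem detCoshAt_zero : detCoshAt L A 0 = 1 := by
  have h : matCosh (0 : Matrix (Fin (n + 1)) (Fin (n + 1)) ℂ) = 1 := by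
    rw [matCosh, neg_zero, NormedSpace.exp_zero, ← two_smul ℂ, smul_smul]
    norm_num
  simp [detCoshAt, h]

/-- The logarithmic derivative of `det cosh (s t L A)` in `s`. -/
def logDerivDetCosh (t : ℂ) (s : ℝ) : ℂ :=
  t * deriv (detCoshAt L A) ((s : ℂ) * t) / detCoshAt L A ((s : ℂ) * t)

/-- The branch of `det^{-1/2} cosh (t L A)` obtained by continuation along segments. -/
def detInvSqrt (t : ℂ) : ℂ :=
  Complex.exp (-(1 / 2) * ∫ s in (0 : ℝ)..1, logDerivDetCosh L A t s)

theorem detInvSqrt_zero : detInvSqrt L A 0 = 1 := by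
  simp [detInvSqrt, logDerivDetCosh]

variable {L A}

/-- Along the segment, `exp(-∫ logDerivDetCosh)` times the determinant has derivative zero, and it
equals `1` at the start. -/
theorem detInvSqrt_sq_mul {t : ℂ}
    (ht : ∀ s ∈ Set.Icc (0 : ℝ) 1, detCoshAt L A ((s : ℂ) * t) ≠ 0) :
    detInvSqrt L A t ^ 2 * detCoshAt L A t = 1 := by
  have hd : ∀ s : ℝ, HasDerivAt (fun s : ℝ => detCoshAt L A ((s : ℂ) * t))
      (t * deriv (detCoshAt L A) ((s : ℂ) * t)) s := by
    intro s
    have h1 := (analyticAt_detCoshAt L A ((s : ℂ) * t)).differentiableAt.hasDerivAt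
    have h2 : HasDerivAt (fun s : ℝ => (s : ℂ) * t) t s := by
      simpa using (Complex.ofRealCLM.hasDerivAt (x := s)).mul_const t
    have h3 := h1.scomp s h2
    exact h3
  have hcd : Continuous fun s : ℝ => detCoshAt L A ((s : ℂ) * t) :=
    continuous_iff_continuousAt.2 fun s => (hd s).continuousAt
  have hcd' : Continuous fun s : ℝ => deriv (detCoshAt L A) ((s : ℂ) * t) := by
    have : Continuous (deriv (detCoshAt L A)) := continuous_iff_continuousAt.2 fun s =>
      (analyticAt_detCoshAt L A s).deriv.continuousAt
    exact this.comp (by fun_prop)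
  set O : Set ℝ := {s | detCoshAt L A ((s : ℂ) * t) ≠ 0} with hO
  have hOo : IsOpen O := isOpen_ne.preimage hcd
  have hk : ContinuousOn (logDerivDetCosh L A t) O :=
    (continuous_const.mul hcd').continuousOn.div hcd.continuousOn fun s hs => hs
  have hsub : Set.Icc (0 : ℝ) 1 ⊆ O := ht
  have hint : ∀ s ∈ Set.Icc (0 : ℝ) 1,
      HasDerivAt (fun s => ∫ r in (0 : ℝ)..s, logDerivDetCosh L A t r)
        (logDerivDetCosh L A t s) s := by
    intro s hs
    refine intervalIntegral.integral_hasDerivAt_right ?_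
      (hk.stronglyMeasurableAtFilter hOo s (hsub hs)) (hk.continuousAt (hOo.mem_nhds (hsub hs)))
    refine (hk.mono ?_).intervalIntegrable
    rw [Set.uIcc_of_le hs.1]
    exact (Set.Icc_subset_Icc_right hs.2).trans hsub
  have hφ : ∀ s ∈ Set.Icc (0 : ℝ) 1, HasDerivAt (fun s : ℝ =>
      Complex.exp (-∫ r in (0 : ℝ)..s, logDerivDetCosh L A t r) *
        detCoshAt L A ((s : ℂ) * t)) 0 s := by
    intro s hs
    have h := ((hint s hs).fun_neg.cexp).fun_mul (hd s)
    refine h.congr_deriv ?_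
    have h1 : logDerivDetCosh L A t s * detCoshAt L A ((s : ℂ) * t) =
        t * deriv (detCoshAt L A) ((s : ℂ) * t) := div_mul_cancel₀ _ (ht s hs)
    linear_combination
      (-Complex.exp (-∫ r in (0 : ℝ)..s, logDerivDetCosh L A t r)) * h1
  have hconst := constant_of_has_deriv_right_zero
    (fun s hs => (hφ s hs).continuousAt.continuousWithinAt)
    (fun s hs => (hφ s (Set.Ico_subset_Icc_self hs)).hasDerivWithinAt) 1 (by simp)
  simp only [intervalIntegral.integral_same, neg_zero, Complex.exp_zero, Complex.ofReal_zero,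
    zero_mul, detCoshAt_zero, mul_one, Complex.ofReal_one, one_mul] at hconst
  rw [← hconst, detInvSqrt, ← Complex.exp_nat_mul]
  congr 2
  push_cast
  ring

end Branch

/-! ### The domain `expDomain` and analyticity of the branch on it. -/

section Domain

variable (Λ : Matrix (Fin (n + 1)) (Fin (n + 1)) (MvPolynomial (Fin (n + 1)) ℂ))
  (A : Matrix (Fin (n + 1)) (Fin (n + 1)) ℂ)

theorem analyticAt_detCosh (p : ℂ × V n) :
    AnalyticAt ℂ (fun p : ℂ × V n => detCosh Λ A p.1 p.2) p :=
  analyticAt_det_matCosh A (fun α β => analyticAt_snd_comp p (analyticAt_matAt Λ α β p.2))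
    analyticAt_fst

theorem continuous_detCosh : Continuous fun p : ℂ × V n => detCosh Λ A p.1 p.2 :=
  continuous_iff_continuousAt.2 fun p => (analyticAt_detCosh Λ A p).continuousAt

/-- The segment is compact, so nonvanishing along it persists under small changes of `(t, Z)`. -/
theorem isOpen_expDomain : IsOpen (expDomain Λ A) := by
  rw [isOpen_iff_mem_nhds]
  intro p hp
  refine isCompact_Icc.eventually_forall_of_forall_eventually fun s hs => ?_
  have hc : Continuous fun q : (ℂ × V n) × ℝ => detCosh Λ A ((q.2 : ℂ) * q.1.1) q.1.2 :=
    (continuous_detCosh Λ A).comp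
      (f := fun q : (ℂ × V n) × ℝ => ((q.2 : ℂ) * q.1.1, q.1.2)) (by fun_prop)
  exact (hc.continuousAt (x := (p, s))).eventually_ne (hp s hs)

theorem isTimeStar_expDomain : IsTimeStar (expDomain Λ A) := by
  intro t z h s hs r hr
  have := h (r * s) ⟨mul_nonneg hr.1 hs.1, mul_le_one₀ hr.2 hs.1 hs.2⟩
  simpa [mul_assoc] using this

theorem zero_mem_expDomain (z : V n) : ((0 : ℂ), z) ∈ expDomain Λ A := by
  intro s _
  change detCoshAt (matAt Λ z) A _ ≠ 0
  simp

theorem detCosh_ne_zero {t : ℂ} {z : V n} (h : (t, z) ∈ expDomain Λ A) :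
    detCosh Λ A t z ≠ 0 := by
  simpa using h 1 (by simp)

theorem continuousOn_detInvSqrt :
    ContinuousOn (fun p : ℂ × V n => detInvSqrt (matAt Λ p.2) A p.1) (expDomain Λ A) := by
  rw [continuousOn_iff_continuous_domRestrict]
  have hu : AnalyticOnNhd ℂ (fun p : ℂ × V n => detCosh Λ A p.1 p.2) Set.univ :=
    fun p _ => analyticAt_detCosh Λ A p
  have hd : Continuous (dirDeriv (1, 0) fun p : ℂ × V n => detCosh Λ A p.1 p.2) :=
    continuous_iff_continuousAt.2 fun p => (analyticOnNhd_dirDeriv hu _ p trivial).continuousAt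
  have hderiv : ∀ t z, deriv (detCoshAt (matAt Λ z) A) t =
      dirDeriv (1, 0) (fun p : ℂ × V n => detCosh Λ A p.1 p.2) (t, z) := fun t z =>
    (hasDerivAt_time (p := (t, z)) (analyticAt_detCosh Λ A (t, z)).differentiableAt).deriv
  -- The denominator is known to be nonzero only for `s` in `[0, 1]`. Clamping `s` to this interval
  -- makes the integrand continuous for all real `s` without changing the integral.
  have hcont : Continuous (Function.uncurry fun (p : expDomain Λ A) (s : ℝ) =>
      logDerivDetCosh (matAt Λ p.1.2) A p.1.1 (Set.projIcc (0 : ℝ) 1 zero_le_one s : ℝ)) := by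
    have hq : Continuous fun q : expDomain Λ A × ℝ =>
        (((Set.projIcc (0 : ℝ) 1 zero_le_one q.2 : ℝ) : ℂ) * q.1.1.1, q.1.1.2) := by
      have : Continuous fun q : expDomain Λ A × ℝ =>
          (Set.projIcc (0 : ℝ) 1 zero_le_one q.2 : ℝ) :=
        continuous_subtype_val.comp (continuous_projIcc.comp continuous_snd)
      fun_prop
    have h1 := (continuous_detCosh Λ A).comp hq
    have h2 := hd.comp hq
    have h3 : Continuous fun q : expDomain Λ A × ℝ => q.1.1.1 := by fun_prop
    refine ((h3.mul h2).div h1 fun q => q.1.2 _ (Subtype.prop _)).congr fun q => ?_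
    simp only [Function.uncurry, logDerivDetCosh, hderiv]
    rfl
  have hI := intervalIntegral.continuous_parametric_intervalIntegral_of_continuous'
    (μ := MeasureTheory.volume) hcont 0 1
  refine (Complex.continuous_exp.comp ((continuous_const (y := (-(1 / 2) : ℂ))).mul hI)).congr fun p => ?_
  refine congrArg (fun c : ℂ => Complex.exp (-(1 / 2) * c)) (intervalIntegral.integral_congr ?_)
  intro s hs
  rw [Set.uIcc_of_le zero_le_one] at hs
  simp only [Set.projIcc_of_mem zero_le_one hs]

theorem isDetInvSqrt_detInvSqrt : IsDetInvSqrt Λ A fun t z => detInvSqrt (matAt Λ z) A t where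
  continuousOn := continuousOn_detInvSqrt Λ A
  initial _ := detInvSqrt_zero _ _
  sq_mul _ _ h := detInvSqrt_sq_mul h

variable {Λ A}

/-- Near a point of the domain the principal logarithm yields a holomorphic inverse root `r` with
the same value there as `g`. The quotient `g / r` is continuous, has square `1`, and equals `1` at
the point, so it is `1` nearby. -/
theorem IsDetInvSqrt.analyticOnNhd {g : ℂ → V n → ℂ} (hg : IsDetInvSqrt Λ A g) :
    AnalyticOnNhd ℂ (fun p : ℂ × V n => g p.1 p.2) (expDomain Λ A) := by
  rintro ⟨t, z⟩ hp
  have hδ := analyticAt_detCosh Λ A (t, z)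
  have hδ0 : detCosh Λ A t z ≠ 0 := detCosh_ne_zero Λ A hp
  have hgsq := hg.sq_mul t z hp
  have hg0 : g t z ≠ 0 := by
    intro h
    simp [h] at hgsq
  have hq : AnalyticAt ℂ (fun p : ℂ × V n => detCosh Λ A p.1 p.2 / detCosh Λ A t z) (t, z) :=
    hδ.div analyticAt_const hδ0
  have hslit : (fun p : ℂ × V n => detCosh Λ A p.1 p.2 / detCosh Λ A t z) (t, z) ∈
      Complex.slitPlane := by
    simp [div_self hδ0]
  set r : ℂ × V n → ℂ := fun p =>
    g t z * Complex.exp (-(1 / 2) * Complex.log (detCosh Λ A p.1 p.2 / detCosh Λ A t z)) with hr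
  have hra : AnalyticAt ℂ r (t, z) :=
    analyticAt_const.mul (analyticAt_const.mul (hq.clog hslit)).cexp'
  have hr0 : ∀ p, r p ≠ 0 := fun p => mul_ne_zero hg0 (Complex.exp_ne_zero _)
  have hgc : ContinuousAt (fun p : ℂ × V n => g p.1 p.2) (t, z) :=
    hg.continuousOn.continuousAt ((isOpen_expDomain Λ A).mem_nhds hp)
  have hquot : ContinuousAt (fun p : ℂ × V n => g p.1 p.2 / r p) (t, z) :=
    hgc.div hra.continuousAt (hr0 _)
  have hval : (fun p : ℂ × V n => g p.1 p.2 / r p) (t, z) = 1 := by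
    simp [hr, div_self hδ0, div_self hg0]
  have hne : ∀ᶠ p in 𝓝 (t, z), g p.1 p.2 / r p ≠ -1 :=
    hquot.eventually_ne (fun h => by have := hval.symm.trans h; norm_num at this)
  have hsq : ∀ᶠ p in 𝓝 (t, z), (g p.1 p.2 / r p) ^ 2 = 1 := by
    filter_upwards [(isOpen_expDomain Λ A).mem_nhds hp] with p hp'
    have h1 := hg.sq_mul p.1 p.2 hp'
    have h2 : detCosh Λ A p.1 p.2 ≠ 0 := detCosh_ne_zero Λ A hp'
    have h3 : r p ^ 2 * detCosh Λ A p.1 p.2 = 1 := by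
      simp only [hr, mul_pow, ← Complex.exp_nat_mul]
      have : ((2 : ℕ) : ℂ) * (-(1 / 2) *
          Complex.log (detCosh Λ A p.1 p.2 / detCosh Λ A t z)) =
          -Complex.log (detCosh Λ A p.1 p.2 / detCosh Λ A t z) := by
        push_cast; ring
      rw [this, Complex.exp_neg, Complex.exp_log (div_ne_zero h2 hδ0)]
      field_simp
      exact hgsq
    rw [div_pow, div_eq_one_iff_eq (pow_ne_zero 2 (hr0 p))]
    exact mul_right_cancel₀ h2 (h1.trans h3.symm)
  refine hra.congr ?_
  filter_upwards [hne, hsq] with p h1 h2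
  have h3 := (sq_eq_one_iff.1 h2).resolve_right h1
  exact ((div_eq_one_iff_eq (hr0 p)).1 h3).symm

end Domain

/-! ### The closed form and its derivatives in `Z` and `t`. -/

section Solution

/-- Differentiating `exp(q/μ)` in `q` multiplies it by `μ^{-1}`, which shifts the coefficient index
up by one. At `m = 0` the coefficient is the constant `1`, and its derivative is the zero
coefficient at `m = 1`. -/
theorem hasDerivAt_expOverMu (m : ℤ) (q : ℂ) :
    HasDerivAt (fun q => expOverMu q m) (expOverMu q (m + 1)) q := by
  unfold expOverMu
  rcases lt_trichotomy m 0 with hm | rfl | hm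
  · obtain ⟨j, rfl⟩ : ∃ j : ℕ, m = -((j : ℤ) + 1) := ⟨(-m - 1).toNat, by omega⟩
    have h1 : -((j : ℤ) + 1) ≤ 0 := by omega
    have h2 : -((j : ℤ) + 1) + 1 ≤ 0 := by omega
    have h3 : (-(-((j : ℤ) + 1))).toNat = j + 1 := by omega
    have h4 : (-(-((j : ℤ) + 1) + 1)).toNat = j := by omega
    simp only [h1, h2, if_true, h3, h4]
    refine ((hasDerivAt_pow (j + 1) q).div_const _).congr_deriv ?_
    rw [Nat.factorial_succ]
    push_cast
    have : (j.factorial : ℂ) ≠ 0 := by exact_mod_cast j.factorial_ne_zero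
    have : (j : ℂ) + 1 ≠ 0 := by exact_mod_cast j.succ_ne_zero
    field_simp
  · simpa using hasDerivAt_const q (1 : ℂ)
  · have h1 : ¬ m ≤ 0 := by omega
    have h2 : ¬ m + 1 ≤ 0 := by omega
    simpa only [h1, h2, if_false] using hasDerivAt_const q (0 : ℂ)

theorem analyticAt_expOverMu (m : ℤ) (q : ℂ) : AnalyticAt ℂ (fun q => expOverMu q m) q := by
  unfold expOverMu
  split_ifs
  · exact (analyticAt_id.pow _).div_const
  · exact analyticAt_const

theorem fderiv_apply_eq_sum_partialD (f : V n → ℂ) (z v : V n) :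
    fderiv ℂ f z v = ∑ β, v β * partialD β f z := by
  rw [← ContinuousLinearMap.coe_coe, LinearMap.pi_apply_eq_sum_univ]
  refine Finset.sum_congr rfl fun β _ => ?_
  have h : (fun i => if β = i then (1 : ℂ) else 0) = Pi.single β 1 := by
    ext i
    simp [Pi.single_apply, eq_comm]
  rw [h]
  rfl

/-- The direction `w` is frozen, so no derivatives of coefficients appear, just as in the
`#`-product. -/
theorem fderiv_fderiv_eq_sum_partialD {f : V n → ℂ} {z : V n} (v w : V n)
    (hf : ∀ β, DifferentiableAt ℂ (partialD β f) z) :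
    fderiv ℂ (fun z' => fderiv ℂ f z' w) z v =
      ∑ β, ∑ β', (v β * w β') * partialD β (partialD β' f) z := by
  have e : (fun z' => fderiv ℂ f z' w) = fun z' => ∑ β', w β' * partialD β' f z' :=
    funext fun z' => fderiv_apply_eq_sum_partialD f z' w
  rw [fderiv_apply_eq_sum_partialD, e]
  refine Finset.sum_congr rfl fun β _ => ?_
  rw [partialD, fderiv_fun_sum fun β' _ => (hf β').const_mul _, sum_apply,
    Finset.mul_sum]
  refine Finset.sum_congr rfl fun β' _ => ?_
  rw [fderiv_const_mul (hf β'), mul_assoc]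
  rfl

variable (Λ : Matrix (Fin (n + 1)) (Fin (n + 1)) (MvPolynomial (Fin (n + 1)) ℂ))
  (A : Matrix (Fin (n + 1)) (Fin (n + 1)) ℂ)

/-- The closed form of the `#`-exponential. -/
def expSol (m : ℤ) (t : ℂ) (z : V n) : ℂ :=
  detInvSqrt (matAt Λ z) A t * expOverMu (quadForm (lamInvTan (matAt Λ z) (t • A)) z) m

theorem analyticOnNhd_expSol (m : ℤ) :
    AnalyticOnNhd ℂ (fun p : ℂ × V n => expSol Λ A m p.1 p.2) (expDomain Λ A) := by
  intro p hp
  have hL : ∀ i j, AnalyticAt ℂ (fun p : ℂ × V n => matAt Λ p.2 i j) p := fun α β =>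
    analyticAt_snd_comp p (analyticAt_matAt Λ α β p.2)
  have hz : ∀ i, AnalyticAt ℂ (fun p : ℂ × V n => p.2 i) p := fun i =>
    analyticAt_snd_comp (f := fun z : V n => z i) p
      ((ContinuousLinearMap.proj (R := ℂ) (φ := fun _ : Fin (n + 1) => ℂ) i).analyticAt p.2)
  have hq : AnalyticAt ℂ (fun p : ℂ × V n =>
      quadForm (lamInvTan (matAt Λ p.2) (p.1 • A)) p.2) p := by
    unfold quadForm
    simp only [Matrix.mulVec, dotProduct]
    exact Finset.univ.analyticAt_fun_sum fun i _ => (hz i).mul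
      (Finset.univ.analyticAt_fun_sum fun j _ => (analyticAt_lamInvTan A hL analyticAt_fst
        (detCosh_ne_zero Λ A hp) i j).mul (hz j))
  exact ((isDetInvSqrt_detInvSqrt Λ A).analyticOnNhd p hp).mul
    ((analyticAt_expOverMu m _).comp hq)

variable {Λ A}

theorem analyticAt_expSol_slice (Λ) (A) {t : ℂ} {z : V n} (hz : (t, z) ∈ expDomain Λ A) (m : ℤ) :
    AnalyticAt ℂ (expSol Λ A m t) z :=
  (analyticOnNhd_expSol Λ A m (t, z) hz).comp (f := fun z : V n => (t, z))
    (analyticAt_const.prod analyticAt_id)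

theorem matAt_transpose (Λ) (hskew : IsSkew Λ) (z : V n) : (matAt Λ z)ᵀ = -matAt Λ z := by
  ext α β
  have := congrArg (MvPolynomial.eval z) (hskew β α)
  simpa [matAt] using this

theorem lamInvTan_isSymm (Λ) (hskew : IsSkew Λ) (hA : A.IsSymm) {t : ℂ} {z : V n}
    (hz : (t, z) ∈ expDomain Λ A) : (lamInvTan (matAt Λ z) (t • A)).IsSymm :=
  lamInvTan_transpose (matAt_transpose Λ hskew z) (by rw [Matrix.transpose_smul, hA.eq])
    (detCosh_ne_zero Λ A hz)

theorem matAt_add_smul_vecMul (hΛ : ∀ a b c, ∑ δ, Λ a δ * MvPolynomial.pderiv δ (Λ b c) = 0)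
    (z w : V n) (s : ℂ) : matAt Λ (z + s • (w ᵥ* matAt Λ z)) = matAt Λ z := by
  rw [← Matrix.smul_vecMul]
  exact matAt_add_vecMul hΛ z (s • w)

theorem hasDerivAt_expSol_line {t : ℂ} {L : Matrix (Fin (n + 1)) (Fin (n + 1)) ℂ}
    (hT : (lamInvTan L (t • A)).IsSymm) (c : ℂ) (m : ℤ) (z v : V n) :
    HasDerivAt (fun s : ℂ => c * expOverMu (quadForm (lamInvTan L (t • A)) (z + s • v)) m)
      (c * (expOverMu (quadForm (lamInvTan L (t • A)) z) (m + 1) *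
        (2 * (v ⬝ᵥ (lamInvTan L (t • A) *ᵥ z))))) 0 := by
  have h1 := hasDerivAt_quadForm_line _ hT z v
  have h2 := hasDerivAt_expOverMu m (quadForm (lamInvTan L (t • A)) (z + (0 : ℂ) • v))
  have h3 := (HasDerivAt.comp (0 : ℂ) h2 h1).const_mul c
  simpa using h3

/-- Along the row space of `Λ(z)`, only the explicit dependence of the solution on `Z` counts. -/
theorem fderiv_expSol (hΛ : ∀ a b c, ∑ δ, Λ a δ * MvPolynomial.pderiv δ (Λ b c) = 0)
    (hskew : IsSkew Λ) (hA : A.IsSymm) {t : ℂ} {z : V n} (hz : (t, z) ∈ expDomain Λ A)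
    (m : ℤ) (w : V n) :
    fderiv ℂ (expSol Λ A m t) z (w ᵥ* matAt Λ z) =
      detInvSqrt (matAt Λ z) A t * (expOverMu (quadForm (lamInvTan (matAt Λ z) (t • A)) z)
        (m + 1) * (2 * ((w ᵥ* matAt Λ z) ⬝ᵥ (lamInvTan (matAt Λ z) (t • A) *ᵥ z)))) := by
  have hT := lamInvTan_isSymm Λ hskew hA hz
  refine fderiv_eq_of_hasDerivAt_line
    (analyticAt_expSol_slice Λ A hz m).differentiableAt ?_
  refine (hasDerivAt_expSol_line hT (detInvSqrt (matAt Λ z) A t) m z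
    (w ᵥ* matAt Λ z)).congr_of_eventuallyEq (Filter.Eventually.of_forall fun s => ?_)
  -- On this line `Λ` is constant, and with it the determinant factor and `T`.
  simp only [expSol, matAt_add_smul_vecMul hΛ]

/-- On the line `z + s • (w ᵥ* Λ(z))` the matrix stays `Λ(z)`, so `w' ᵥ* Λ(z)` is a row-space
direction at each of its points. The first-derivative formula thus holds along the line near `s = 0`
and can be differentiated once more with `Λ` fixed. -/
theorem fderiv_fderiv_expSol (hΛ : ∀ a b c, ∑ δ, Λ a δ * MvPolynomial.pderiv δ (Λ b c) = 0)
    (hskew : IsSkew Λ) (hA : A.IsSymm) {t : ℂ} {z : V n} (hz : (t, z) ∈ expDomain Λ A)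
    (m : ℤ) (w w' : V n) :
    fderiv ℂ (fun z' => fderiv ℂ (expSol Λ A m t) z' (w' ᵥ* matAt Λ z)) z (w ᵥ* matAt Λ z) =
      detInvSqrt (matAt Λ z) A t * (
        expOverMu (quadForm (lamInvTan (matAt Λ z) (t • A)) z) (m + 2) *
          (2 * ((w ᵥ* matAt Λ z) ⬝ᵥ (lamInvTan (matAt Λ z) (t • A) *ᵥ z))) *
          (2 * ((w' ᵥ* matAt Λ z) ⬝ᵥ (lamInvTan (matAt Λ z) (t • A) *ᵥ z))) +
        expOverMu (quadForm (lamInvTan (matAt Λ z) (t • A)) z) (m + 1) *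
          (2 * ((w' ᵥ* matAt Λ z) ⬝ᵥ (lamInvTan (matAt Λ z) (t • A) *ᵥ
            (w ᵥ* matAt Λ z))))) := by
  have hT := lamInvTan_isSymm Λ hskew hA hz
  have hd : DifferentiableAt ℂ
      (fun z' => fderiv ℂ (expSol Λ A m t) z' (w' ᵥ* matAt Λ z)) z :=
    ((ContinuousLinearMap.apply ℂ ℂ (w' ᵥ* matAt Λ z)).differentiableAt).comp z
      (analyticAt_expSol_slice Λ A hz m).fderiv.differentiableAt
  refine fderiv_eq_of_hasDerivAt_line hd ?_
  have h1 := hasDerivAt_expSol_line hT (detInvSqrt (matAt Λ z) A t) (m + 1) z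
    (w ᵥ* matAt Λ z)
  have h2 : HasDerivAt (fun s : ℂ => 2 * ((w' ᵥ* matAt Λ z) ⬝ᵥ
      (lamInvTan (matAt Λ z) (t • A) *ᵥ (z + s • (w ᵥ* matAt Λ z)))))
      (2 * ((w' ᵥ* matAt Λ z) ⬝ᵥ (lamInvTan (matAt Λ z) (t • A) *ᵥ (w ᵥ* matAt Λ z)))) 0 := by
    simp only [Matrix.mulVec_add, Matrix.mulVec_smul, dotProduct_add, dotProduct_smul,
      smul_eq_mul]
    simpa using ((((hasDerivAt_id (0 : ℂ)).mul_const _).const_add _).const_mul (2 : ℂ))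
  have h3 := h1.fun_mul h2
  have hO : ∀ᶠ s : ℂ in 𝓝 0, (t, z + s • (w ᵥ* matAt Λ z)) ∈ expDomain Λ A := by
    have hc : Continuous fun s : ℂ => (t, z + s • (w ᵥ* matAt Λ z)) := by fun_prop
    exact hc.continuousAt.eventually
      ((isOpen_expDomain Λ A).mem_nhds (by simpa using hz))
  have e : (fun s : ℂ => fderiv ℂ (expSol Λ A m t) (z + s • (w ᵥ* matAt Λ z))
      (w' ᵥ* matAt Λ z)) =ᶠ[𝓝 0] fun s => detInvSqrt (matAt Λ z) A t *
        expOverMu (quadForm (lamInvTan (matAt Λ z) (t • A)) (z + s • (w ᵥ* matAt Λ z))) (m + 1) *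
        (2 * ((w' ᵥ* matAt Λ z) ⬝ᵥ
          (lamInvTan (matAt Λ z) (t • A) *ᵥ (z + s • (w ᵥ* matAt Λ z))))) := by
    filter_upwards [hO] with s hs
    have h := fderiv_expSol hΛ hskew hA hs m w'
    rw [matAt_add_smul_vecMul hΛ] at h
    rw [h, mul_assoc]
  refine (h3.congr_of_eventuallyEq e).congr_deriv ?_
  rw [zero_smul, add_zero, show m + 1 + 1 = m + 2 by ring]
  ring

/-- The time derivative of the solution, from the Riccati equation. -/
theorem hasDerivAt_expSol_time {t : ℂ} {z : V n} (hz : (t, z) ∈ expDomain Λ A) (m : ℤ) :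
    HasDerivAt (fun τ => expSol Λ A m τ z)
      (detInvSqrt (matAt Λ z) A t * (
        expOverMu (quadForm (lamInvTan (matAt Λ z) (t • A)) z) (m + 1) *
          quadForm (A + A * matAt Λ z * lamInvTan (matAt Λ z) (t • A) -
            lamInvTan (matAt Λ z) (t • A) * matAt Λ z * A -
            lamInvTan (matAt Λ z) (t • A) * matAt Λ z * A * matAt Λ z *
              lamInvTan (matAt Λ z) (t • A)) z -
        expOverMu (quadForm (lamInvTan (matAt Λ z) (t • A)) z) m *
          (1 / 2 * (matAt Λ z * A * matAt Λ z * lamInvTan (matAt Λ z) (t • A)).trace))) t := by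
  have hdet : detCosh Λ A t z ≠ 0 := detCosh_ne_zero Λ A hz
  set L := matAt Λ z with hL
  have hg : DifferentiableAt ℂ (detInvSqrt L A) t :=
    (hasDerivAt_time (p := (t, z)) (u := fun p : ℂ × V n => detInvSqrt (matAt Λ p.2) A p.1)
      ((isDetInvSqrt_detInvSqrt Λ A).analyticOnNhd _ hz).differentiableAt).differentiableAt
  have hδ : HasDerivAt (fun s : ℂ => (matCosh (L * (s • A))).det)
      ((matCosh (L * (t • A))).det * (L * A * L * lamInvTan L (t • A)).trace) t :=
    hasDerivAt_det_matCosh hdet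
  have hsq : (fun τ => detInvSqrt L A τ ^ 2 * (matCosh (L * (τ • A))).det) =ᶠ[𝓝 t]
      fun _ => 1 := by
    filter_upwards [(isOpen_spaceSlice (isOpen_expDomain Λ A) z).mem_nhds hz] with τ hτ
    exact (isDetInvSqrt_detInvSqrt Λ A).sq_mul τ z hτ
  -- Differentiating `g^2 det cosh = 1` and dividing by `2 g det cosh` gives `g' = -(1/2) tr(LALT)
  -- g`.
  have h0 := ((hg.hasDerivAt.fun_pow 2).fun_mul hδ).unique
    ((hasDerivAt_const t (1 : ℂ)).congr_of_eventuallyEq hsq)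
  have hsq' := hsq.self_of_nhds
  have hg0 : detInvSqrt L A t ≠ 0 := Complex.exp_ne_zero _
  have hg' : deriv (detInvSqrt L A) t =
      -(detInvSqrt L A t * (1 / 2 * (L * A * L * lamInvTan L (t • A)).trace)) := by
    have hdet' : (matCosh (L * (t • A))).det ≠ 0 := hdet
    have h1 : (2 * detInvSqrt L A t * (matCosh (L * (t • A))).det) *
        (deriv (detInvSqrt L A) t +
          detInvSqrt L A t * (1 / 2 * (L * A * L * lamInvTan L (t • A)).trace)) = 0 := by
      simp only [Nat.cast_ofNat, Nat.add_one_sub_one, pow_one] at h0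
      linear_combination h0
    have h2 := (mul_eq_zero.1 h1).resolve_left
      (mul_ne_zero (mul_ne_zero two_ne_zero hg0) hdet')
    linear_combination h2
  have hq : HasDerivAt (fun τ : ℂ => quadForm (lamInvTan L (τ • A)) z)
      (quadForm (A + A * L * lamInvTan L (t • A) - lamInvTan L (t • A) * L * A -
        lamInvTan L (t • A) * L * A * L * lamInvTan L (t • A)) z) t := by
    simp only [quadForm, Matrix.mulVec, dotProduct]
    exact HasDerivAt.fun_sum fun i _ => (HasDerivAt.fun_sum fun j _ =>
      (hasDerivAt_lamInvTan hdet i j).mul_const (z j)).const_mul (z i)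
  have hE := HasDerivAt.comp t (hasDerivAt_expOverMu m (quadForm (lamInvTan L (t • A)) z)) hq
  refine (hg.hasDerivAt.fun_mul hE).congr_deriv ?_
  rw [hg']
  simp only [Function.comp]
  ring

end Solution

/-! ### The closed form solves the evolution equation; uniqueness and maximality of its domain. -/

section Evolution

variable {Λ : Matrix (Fin (n + 1)) (Fin (n + 1)) (MvPolynomial (Fin (n + 1)) ℂ)}
  {A : Matrix (Fin (n + 1)) (Fin (n + 1)) ℂ}

/-- Moving `T` and `L` across the pairing costs one sign, as `L` is skew. The three summands on the
right are the contributions of order zero, one and two of `A[Z] #` that carry only gradients of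
`T[Z]`. -/
theorem quadForm_riccati {L T A : Matrix (Fin (n + 1)) (Fin (n + 1)) ℂ} (hL : Lᵀ = -L)
    (hT : T.IsSymm) (hA : A.IsSymm) (z : V n) :
    quadForm (A + A * L * T - T * L * A - T * L * A * L * T) z =
      quadForm A z + 2 * ((A *ᵥ z) ⬝ᵥ (L *ᵥ (T *ᵥ z))) + quadForm A (L *ᵥ (T *ᵥ z)) := by
  have hTL : ∀ x : V n, z ⬝ᵥ (T *ᵥ (L *ᵥ x)) = -((L *ᵥ (T *ᵥ z)) ⬝ᵥ x) := by
    intro x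
    rw [Matrix.dotProduct_mulVec, Matrix.dotProduct_mulVec, ← Matrix.mulVec_transpose,
      ← Matrix.mulVec_transpose, hT.eq, hL, Matrix.neg_mulVec, neg_dotProduct]
  have hAz : ∀ x : V n, z ⬝ᵥ (A *ᵥ x) = (A *ᵥ z) ⬝ᵥ x := by
    intro x
    rw [Matrix.dotProduct_mulVec, ← Matrix.mulVec_transpose, hA.eq]
  simp only [quadForm, Matrix.sub_mulVec, Matrix.add_mulVec, dotProduct_sub, dotProduct_add,
    ← Matrix.mulVec_mulVec, hTL]
  rw [hAz (L *ᵥ (T *ᵥ z)), dotProduct_comm (L *ᵥ (T *ᵥ z)) (A *ᵥ z)]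
  ring

/-- Pairing the rows of `L` through `T` gives the entries of `L T Lᵀ`; skewness of `L` supplies the
sign. This is the Hessian contribution, which the derivative of the determinant factor must match.
-/
theorem sum_mul_dotProduct_mulVec {L T A : Matrix (Fin (n + 1)) (Fin (n + 1)) ℂ} (hL : Lᵀ = -L) :
    ∑ α, ∑ α', A α α' * ((Pi.single α' 1 ᵥ* L) ⬝ᵥ (T *ᵥ (Pi.single α 1 ᵥ* L))) =
      -(L * A * L * T).trace := by
  have h : ∀ α α', (Pi.single α' 1 ᵥ* L) ⬝ᵥ (T *ᵥ (Pi.single α 1 ᵥ* L)) =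
      (L * T * Lᵀ) α' α := by
    intro α α'
    rw [Matrix.single_one_vecMul, Matrix.single_one_vecMul, Matrix.dotProduct_mulVec]
    rfl
  simp only [h]
  have h2 : (A * (L * T * Lᵀ)).trace = -(L * A * L * T).trace := by
    have h3 := Matrix.trace_mul_comm (A * L * T) L
    simp only [← mul_assoc] at h3
    rw [hL, Matrix.mul_neg, Matrix.mul_neg, Matrix.trace_neg, ← h3]
    simp only [mul_assoc]
  rw [← h2]
  rfl

theorem sum_mul_second_order (A : Matrix (Fin (n + 1)) (Fin (n + 1)) ℂ) (g a b : ℂ) (y : V n)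
    (S : Fin (n + 1) → Fin (n + 1) → ℂ) :
    ∑ α, ∑ α', 1 / 4 * A α α' * (g * (a * (2 * y α) * (2 * y α') + b * (2 * S α α'))) =
      g * a * quadForm A y + g * b * (1 / 2) * ∑ α, ∑ α', A α α' * S α α' := by
  simp only [quadForm, dotProduct, Matrix.mulVec, Finset.mul_sum, ← Finset.sum_add_distrib]
  exact Finset.sum_congr rfl fun α _ => Finset.sum_congr rfl fun α' _ => by ring

/-- Terms containing only gradients of `T[Z]` come with the coefficient `m + 1` of the exponential
and add up to the Riccati right-hand side. The Hessian of `T[Z]` comes with the coefficient `m` and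
gives the trace. -/
theorem sharp_expSol (hΛ : ∀ a b c, ∑ δ, Λ a δ * MvPolynomial.pderiv δ (Λ b c) = 0)
    (hskew : IsSkew Λ) (hA : A.IsSymm) {t : ℂ} {z : V n} (hz : (t, z) ∈ expDomain Λ A) (m : ℤ) :
    sharp Λ (quadOverMu A) (fun j => expSol Λ A j t) m z =
      detInvSqrt (matAt Λ z) A t * (
        expOverMu (quadForm (lamInvTan (matAt Λ z) (t • A)) z) (m + 1) *
          quadForm (A + A * matAt Λ z * lamInvTan (matAt Λ z) (t • A) -
            lamInvTan (matAt Λ z) (t • A) * matAt Λ z * A -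
            lamInvTan (matAt Λ z) (t • A) * matAt Λ z * A * matAt Λ z *
              lamInvTan (matAt Λ z) (t • A)) z -
        expOverMu (quadForm (lamInvTan (matAt Λ z) (t • A)) z) m *
          (1 / 2 * (matAt Λ z * A * matAt Λ z * lamInvTan (matAt Λ z) (t • A)).trace)) := by
  have hLt := matAt_transpose Λ hskew z
  have hr : ∀ α : Fin (n + 1), (Pi.single α 1 ᵥ* matAt Λ z) = fun β => matAt Λ z α β := fun α =>
    Matrix.single_one_vecMul α _
  have hry : ∀ (α : Fin (n + 1)) (y : V n), (Pi.single α 1 ᵥ* matAt Λ z) ⬝ᵥ y =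
      (matAt Λ z *ᵥ y) α := by
    intro α y
    rw [hr]; rfl
  have hd : ∀ β, DifferentiableAt ℂ (partialD β (expSol Λ A (m - 1) t)) z := fun β =>
    ((ContinuousLinearMap.apply ℂ ℂ (Pi.single β 1 : V n)).differentiableAt).comp z
      (analyticAt_expSol_slice Λ A hz (m - 1)).fderiv.differentiableAt
  have h1 : ∀ α, ∑ β, (matAt Λ z α β * (A *ᵥ z) α) * partialD β (expSol Λ A m t) z =
      (A *ᵥ z) α * fderiv ℂ (expSol Λ A m t) z (Pi.single α 1 ᵥ* matAt Λ z) := by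
    intro α
    rw [fderiv_apply_eq_sum_partialD, Finset.mul_sum, hr]
    exact Finset.sum_congr rfl fun β _ => by ring
  have h2 : ∀ α α', ∑ β, ∑ β', (1 / 4 * (matAt Λ z α β * matAt Λ z α' β') * A α α') *
      partialD β (partialD β' (expSol Λ A (m - 1) t)) z = 1 / 4 * A α α' *
        fderiv ℂ (fun z' => fderiv ℂ (expSol Λ A (m - 1) t) z' (Pi.single α' 1 ᵥ* matAt Λ z)) z
          (Pi.single α 1 ᵥ* matAt Λ z) := by
    intro α α'
    rw [fderiv_fderiv_eq_sum_partialD _ _ hd, Finset.mul_sum, hr, hr]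
    refine Finset.sum_congr rfl fun β _ => ?_
    rw [Finset.mul_sum]
    exact Finset.sum_congr rfl fun β' _ => by ring
  rw [sharp_quadOverMu Λ A hA]
  simp only [h1, h2, fderiv_expSol hΛ hskew hA hz, fderiv_fderiv_expSol hΛ hskew hA hz]
  rw [show m - 1 + 2 = m + 1 by ring, show m - 1 + 1 = m by ring,
    quadForm_riccati hLt (lamInvTan_isSymm Λ hskew hA hz) hA]
  have htr := sum_mul_dotProduct_mulVec (T := lamInvTan (matAt Λ z) (t • A)) (A := A) hLt
  set T := lamInvTan (matAt Λ z) (t • A)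
  set g := detInvSqrt (matAt Λ z) A t with hg
  set E1 := expOverMu (quadForm T z) (m + 1)
  set E0 := expOverMu (quadForm T z) m
  have hs1 : ∑ α, (A *ᵥ z) α * (g * (E1 * (2 * ((Pi.single α 1 ᵥ* matAt Λ z) ⬝ᵥ (T *ᵥ z))))) =
      g * E1 * (2 * ((A *ᵥ z) ⬝ᵥ (matAt Λ z *ᵥ (T *ᵥ z)))) := by
    simp only [hry]
    rw [dotProduct, Finset.mul_sum, Finset.mul_sum]
    exact Finset.sum_congr rfl fun α _ => by ring
  have hs2 : ∑ α, ∑ α', 1 / 4 * A α α' * (g * (E1 *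
      (2 * ((Pi.single α 1 ᵥ* matAt Λ z) ⬝ᵥ (T *ᵥ z))) *
      (2 * ((Pi.single α' 1 ᵥ* matAt Λ z) ⬝ᵥ (T *ᵥ z))) +
      E0 * (2 * ((Pi.single α' 1 ᵥ* matAt Λ z) ⬝ᵥ (T *ᵥ (Pi.single α 1 ᵥ* matAt Λ z)))))) =
      g * E1 * quadForm A (matAt Λ z *ᵥ (T *ᵥ z)) + g * E0 * (1 / 2) *
        ∑ α, ∑ α', A α α' *
          ((Pi.single α' 1 ᵥ* matAt Λ z) ⬝ᵥ (T *ᵥ (Pi.single α 1 ᵥ* matAt Λ z))) := by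
    rw [← sum_mul_second_order]
    simp only [hry]
  rw [hs1, hs2, htr, expSol]
  ring

theorem isSharpExp_expSol (hΛ : ∀ a b c, ∑ δ, Λ a δ * MvPolynomial.pderiv δ (Λ b c) = 0)
    (hskew : IsSkew Λ) (hA : A.IsSymm) :
    IsSharpExp Λ A (expDomain Λ A) (expSol Λ A) where
  analytic := analyticOnNhd_expSol Λ A
  bounded := ⟨0, fun m hm p _ => by simp [expSol, expOverMu, hm]⟩
  initial m z _ := by
    simp only [expSol, detInvSqrt_zero, one_mul, oneSeries, zero_smul]
    have h : quadForm (lamInvTan (matAt Λ z) 0) z = 0 := by simp [lamInvTan, quadForm]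
    rw [h, expOverMu]
    by_cases hm : m = 0
    · simp [hm]
    · rcases lt_or_gt_of_ne hm with h | h
      · have : (-m).toNat ≠ 0 := by omega
        simp [hm, this]
      · simp [hm, h]
  evolution m t z hz := by
    rw [sharp_expSol hΛ hskew hA hz m]
    exact hasDerivAt_expSol_time hz m

/-- Both functions are analytic at `t = 0`, with Taylor coefficients given by the same iterated
products. -/
theorem IsSharpExp.unique (hA : A.IsSymm) {D D' : Set (ℂ × V n)} {F G : ℤ → ℂ → V n → ℂ}
    (hD : IsOpen D) (hD' : IsOpen D') (hF : IsSharpExp Λ A D F) (hG : IsSharpExp Λ A D' G)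
    {z : V n} (hz : ((0 : ℂ), z) ∈ D) (hz' : ((0 : ℂ), z) ∈ D') (m : ℤ) :
    (fun t => F m t z) =ᶠ[𝓝 0] fun t => G m t z := by
  have hFa : AnalyticAt ℂ (fun t => F m t z) 0 := (hF.analytic m _ hz).comp
    (f := fun t : ℂ => (t, z)) (analyticAt_id.prod analyticAt_const)
  have hGa : AnalyticAt ℂ (fun t => G m t z) 0 := (hG.analytic m _ hz').comp
    (f := fun t : ℂ => (t, z)) (analyticAt_id.prod analyticAt_const)
  have h1 := hFa.hasFPowerSeriesAt
  have h2 := hGa.hasFPowerSeriesAt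
  simp only [hF.iteratedDeriv_zero Λ A hA hD m hz] at h1
  simp only [hG.iteratedDeriv_zero Λ A hA hD' m hz'] at h2
  have h3 := h1.sub h2
  rw [sub_self] at h3
  filter_upwards [h3.eventually_eq_zero] with t ht
  simpa [sub_eq_zero] using ht

theorem isPreconnected_timeStar {S : Set ℂ} (hS : ∀ t ∈ S, ∀ s ∈ Set.Icc (0 : ℝ) 1, (s : ℂ) * t ∈ S) :
    IsPreconnected S := by
  rcases S.eq_empty_or_nonempty with rfl | ⟨x, hx⟩
  · exact isPreconnected_empty
  have h0 : (0 : ℂ) ∈ S := by simpa using hS x hx 0 (by simp)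
  refine (StarConvex.isPathConnected (a := (0 : ℂ)) ?_ h0).isConnected.isPreconnected
  rw [starConvex_zero_iff]
  intro y hy a ha ha1
  simpa using hS y hy a ⟨ha, ha1⟩

/-- A `#`-exponential lives inside `expDomain Λ A`, and is given there by the closed form. -/
theorem IsSharpExp.eq_expSol (hΛ : ∀ a b c, ∑ δ, Λ a δ * MvPolynomial.pderiv δ (Λ b c) = 0)
    (hskew : IsSkew Λ) (hA : A.IsSymm) {D : Set (ℂ × V n)} {G : ℤ → ℂ → V n → ℂ}
    (hD : IsOpen D) (hstar : IsTimeStar D) (hG : IsSharpExp Λ A D G) :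
    D ⊆ expDomain Λ A ∧ ∀ m t z, (t, z) ∈ D → G m t z = expSol Λ A m t z := by
  have hF := isSharpExp_expSol hΛ hskew hA
  have hzero : ∀ t z, (t, z) ∈ D → ((0 : ℂ), z) ∈ D := fun t z h => by
    simpa using hstar t z h 0 (by simp)
  have hloc : ∀ t z, (t, z) ∈ D → ∀ m,
      (fun t => G m t z) =ᶠ[𝓝 0] fun t => expSol Λ A m t z := fun t z h m =>
    hG.unique hA hD (isOpen_expDomain Λ A) hF (hzero t z h) (zero_mem_expDomain Λ A z) m
  have hpre : ∀ z, IsPreconnected {t : ℂ | (t, z) ∈ D} := fun z =>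
    isPreconnected_timeStar fun t ht s hs => hstar t z ht s hs
  have han : ∀ (u : ℂ × V n → ℂ) z, AnalyticOnNhd ℂ u D →
      AnalyticOnNhd ℂ (fun t => u (t, z)) {t : ℂ | (t, z) ∈ D} := fun u z hu t ht =>
    (hu (t, z) ht).comp (f := fun t : ℂ => (t, z)) (analyticAt_id.prod analyticAt_const)
  have hsub : D ⊆ expDomain Λ A := by
    rintro ⟨t, z⟩ h s hs
    -- The `μ^0` coefficient of the closed form is the inverse root alone, so this identity holds
    -- near `τ = 0`. The identity theorem extends it over the connected time slice of `D`, and there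
    -- the determinant cannot vanish.
    have hsq : ∀ τ z, (τ, z) ∈ D → G 0 τ z ^ 2 * detCosh Λ A τ z = 1 := by
      intro τ z hτ
      have h1 : AnalyticOnNhd ℂ (fun p : ℂ × V n => G 0 p.1 p.2 ^ 2 * detCosh Λ A p.1 p.2) D :=
        fun p hp => ((hG.analytic 0 p hp).pow 2).mul (analyticAt_detCosh Λ A p)
      refine (han _ z h1).eqOn_of_preconnected_of_eventuallyEq (g := fun _ => 1)
        analyticOnNhd_const (hpre z) (hzero τ z hτ) ?_ hτ
      filter_upwards [hloc τ z hτ 0, (isOpen_spaceSlice (isOpen_expDomain Λ A) z).mem_nhds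
        (zero_mem_expDomain Λ A z)] with r hr hr'
      simp only [hr]
      have := (isDetInvSqrt_detInvSqrt Λ A).sq_mul r z hr'
      simpa [expSol, expOverMu] using this
    intro h0
    have := hsq _ z (hstar t z h s hs)
    simp only at h0
    simp [h0] at this
  refine ⟨hsub, fun m t z h => ?_⟩
  exact (han _ z (hG.analytic m)).eqOn_of_preconnected_of_eventuallyEq
    (han _ z fun p hp => hF.analytic m p (hsub hp)) (hpre z) (hzero t z h) (hloc t z h m) h

end Evolution

/-! ### Expansion at `Z = 0` into sections of `O(k)`. -/

section Sections

theorem H0.ext_value {k : ℕ} {s s' : H0 n k} (h : ∀ z hz, s.value z hz = s'.value z hz) :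
    s = s' := by
  refine Subtype.ext (funext ?_)
  rintro ⟨z, hz, hz'⟩
  exact h z hz

/-- The section of `O(k)` given by a homogeneous polynomial of degree `k`. -/
def homogeneousSection {k : ℕ} (q : ContinuousMultilinearMap ℂ (fun _ : Fin k => V n) ℂ) :
    H0 n k :=
  ⟨fun z => q fun _ => (z : V n), by
    constructor
    · have h : Differentiable ℂ fun z : V n => q fun _ => z :=
        ((q.contDiff (n := 1)).differentiable one_ne_zero).comp (differentiable_pi.2 fun _ => differentiable_id)
      exact h.differentiableOn.congr fun z hz =>
        Subtype.val_injective.extend_apply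
          (fun z : cone (Set.univ : Set (ℙ ℂ (V n))) => q fun _ => (z : V n)) 0 ⟨z, hz⟩
    · intro c z w h
      simp [h, q.map_smul_univ (fun _ => c) fun _ => (z : V n)]⟩

/-- The sections are the homogeneous Taylor terms of `u` at `0`. Their values are Taylor
coefficients of `u` on lines through the origin, so vanishing can be tested in one variable. -/
theorem exists_sections {u : V n → ℂ} (hu : AnalyticAt ℂ u 0) :
    ∃ s : (k : ℕ) → H0 n k,
      (∀ᶠ z in 𝓝 (0 : V n), ∀ h : z ≠ 0, HasSum (fun k => (s k).value z h) (u z)) ∧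
      ∀ k z h, (s k).value z h =
        iteratedDeriv k (fun c : ℂ => u (c • z)) 0 / (k.factorial : ℂ) := by
  obtain ⟨p, r, hp⟩ := hu
  refine ⟨fun k => homogeneousSection (p k), ?_, ?_⟩
  · filter_upwards [Metric.eball_mem_nhds (0 : V n) hp.r_pos] with z hz _
    simpa [H0.value, homogeneousSection] using hp.hasSum hz
  · intro k z _
    set L : ℂ →L[ℂ] V n := (ContinuousLinearMap.id ℂ ℂ).smulRight z
    have h1 : HasFPowerSeriesAt (u ∘ L) (p.compContinuousLinearMap L) 0 :=
      HasFPowerSeriesAt.compContinuousLinearMap (by simpa [L] using ⟨r, hp⟩)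
    have h2 := h1.eq_formalMultilinearSeries h1.analyticAt.hasFPowerSeriesAt
    have h3 := congrArg (fun q : FormalMultilinearSeries ℂ ℂ ℂ => q.coeff k) h2
    simp only [FormalMultilinearSeries.coeff_ofScalars] at h3
    have h4 : (p.compContinuousLinearMap L).coeff k = p k fun _ => z := by
      simp only [FormalMultilinearSeries.coeff,
        FormalMultilinearSeries.compContinuousLinearMap_apply]
      congr 1
      ext i : 1
      simp [L]
    rw [h4] at h3
    exact h3

theorem quadForm_smul (A : Matrix (Fin (n + 1)) (Fin (n + 1)) ℂ) (c : ℂ) (z : V n) :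
    quadForm A (c • z) = c ^ 2 * quadForm A z := by
  simp only [quadForm, Matrix.mulVec_smul, smul_dotProduct, dotProduct_smul, smul_eq_mul]
  ring

theorem expOverMu_sq_mul (j : ℕ) (c q : ℂ) :
    expOverMu (c ^ 2 * q) (-(j : ℤ)) = c ^ (2 * j) * expOverMu q (-(j : ℤ)) := by
  simp [expOverMu, mul_pow, ← pow_mul, mul_div_assoc]

variable {Λ : Matrix (Fin (n + 1)) (Fin (n + 1)) (MvPolynomial (Fin (n + 1)) ℂ)}
  {A : Matrix (Fin (n + 1)) (Fin (n + 1)) ℂ}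

/-- The Taylor expansion of `F_{-j}` at `Z = 0` starts in degree `2 j`. -/
theorem iteratedDeriv_expSol_eq_zero (h1 : ((1 : ℂ), (0 : V n)) ∈ expDomain Λ A) (j : ℤ) (k : ℕ)
    (hjk : ¬(0 ≤ j ∧ 2 * j ≤ k)) (z : V n) :
    iteratedDeriv k (fun c : ℂ => expSol Λ A (-j) 1 (c • z)) 0 = 0 := by
  rcases lt_or_ge j 0 with hj | hj
  · have h : (fun c : ℂ => expSol Λ A (-j) 1 (c • z)) = fun _ => 0 := by
      ext c
      simp [expSol, expOverMu, hj]
    rw [h]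
    simp
  · lift j to ℕ using hj
    have hk : k < 2 * j := by omega
    have h0 : ((1 : ℂ), (0 : ℂ) • z) ∈ expDomain Λ A := by simpa using h1
    have hline : AnalyticAt ℂ (fun c : ℂ => c • z) 0 := analyticAt_id.smul analyticAt_const
    have hg : AnalyticAt ℂ (fun c : ℂ => detInvSqrt (matAt Λ (c • z)) A 1) 0 :=
      ((isDetInvSqrt_detInvSqrt Λ A).analyticOnNhd _ h0).comp
        (f := fun c : ℂ => ((1 : ℂ), c • z)) (analyticAt_const.prod hline)
    have hL : ∀ α β, AnalyticAt ℂ (fun c : ℂ => matAt Λ (c • z) α β) 0 := fun α β =>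
      (analyticAt_matAt Λ α β ((0 : ℂ) • z)).comp (f := fun c : ℂ => c • z) hline
    have hq : AnalyticAt ℂ (fun c : ℂ =>
        quadForm (lamInvTan (matAt Λ (c • z)) ((1 : ℂ) • A)) z) 0 := by
      simp only [quadForm, Matrix.mulVec, dotProduct]
      exact Finset.univ.analyticAt_fun_sum fun α _ => analyticAt_const.mul
        (Finset.univ.analyticAt_fun_sum fun β _ =>
          (analyticAt_lamInvTan (t := fun _ => 1) A hL analyticAt_const
            (detCosh_ne_zero Λ A h0) α β).mul analyticAt_const)
    have hu : AnalyticAt ℂ (fun c : ℂ => expSol Λ A (-(j : ℤ)) 1 (c • z)) 0 :=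
      (analyticAt_expSol_slice Λ A h0 (-(j : ℤ))).comp (f := fun c : ℂ => c • z) hline
    -- On the line `c • z` the `j`-th power of the quadratic form yields the factor `c^(2j)`. The
    -- cofactor is analytic at `c = 0` because `(1, 0)` lies in the domain, so the order of
    -- vanishing is at least `2j`.
    refine (natCast_le_analyticOrderAt_iff_iteratedDeriv_eq_zero hu).1
      ((natCast_le_analyticOrderAt hu).2 ⟨_, hg.mul ((analyticAt_expOverMu (-(j : ℤ)) _).comp hq),
        Filter.Eventually.of_forall fun c => ?_⟩) k hk
    simp only [expSol, quadForm_smul, expOverMu_sq_mul, sub_zero, smul_eq_mul, Pi.mul_apply,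
      Function.comp]
    ring

theorem matAt_eq_of_isHomogeneous_zero (hΛ : ∀ α β, (Λ α β).IsHomogeneous 0) (z z' : V n) :
    matAt Λ z = matAt Λ z' := by
  ext α β
  have h : Λ α β = MvPolynomial.C (MvPolynomial.coeff 0 (Λ α β)) :=
    MvPolynomial.totalDegree_eq_zero_iff_eq_C.1
      (Nat.le_zero.1 (hΛ α β).totalDegree_le)
  simp only [matAt, Matrix.map_apply]
  rw [h]
  simp

/-- For constant `Λ` neither the determinant nor `T` depends on `Z`, so the coefficient of `μ^{-j}`
is exactly homogeneous of degree `2j`. -/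
theorem iteratedDeriv_expSol_of_isHomogeneous_zero (hΛ : ∀ α β, (Λ α β).IsHomogeneous 0)
    (j k : ℕ) (z : V n) :
    iteratedDeriv k (fun c : ℂ => expSol Λ A (-(j : ℤ)) 1 (c • z)) 0 =
      if k = 2 * j then (k.factorial : ℂ) * expSol Λ A (-(j : ℤ)) 1 z else 0 := by
  have h : (fun c : ℂ => expSol Λ A (-(j : ℤ)) 1 (c • z)) =
      fun c => expSol Λ A (-(j : ℤ)) 1 z * c ^ (2 * j) := by
    ext c
    simp only [expSol, quadForm_smul, expOverMu_sq_mul,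
      matAt_eq_of_isHomogeneous_zero hΛ (c • z) z]
    ring
  rw [h, iteratedDeriv_const_mul_field, iteratedDeriv_fun_pow_zero]
  split_ifs with hk
  · rw [hk]; ring
  · simp

/-- At `t = 1` the closed form expands into sections of the sheaves `O(k)`. -/
theorem exists_laurentSeries_expSol (h1 : ((1 : ℂ), (0 : V n)) ∈ expDomain Λ A) :
    ∃ s : (k : ℕ) → LaurentSeries (H0 n k),
      HasSectionExpansion (fun m => expSol Λ A m 1) s ∧
      (∀ (k : ℕ) (j : ℤ), (s k).coeff j ≠ 0 → 0 ≤ j ∧ 2 * j ≤ k) ∧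
      ((∀ α β, (Λ α β).IsHomogeneous 0) →
        (∀ (k : ℕ) (j : ℤ), (s k).coeff j ≠ 0 → (k : ℤ) = 2 * j) ∧
        ∀ (j : ℕ) (z : V n) (h : z ≠ 0),
          expSol Λ A (-(j : ℤ)) 1 z = ((s (2 * j)).coeff (j : ℤ)).value z h) := by
  choose S hS hS' using fun j : ℤ => exists_sections (analyticAt_expSol_slice Λ A h1 (-j))
  have hzero : ∀ (k : ℕ) (j : ℤ), S j k ≠ 0 → 0 ≤ j ∧ 2 * j ≤ k := by
    intro k j h
    by_contra hjk
    refine h (H0.ext_value fun z hz => ?_)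
    rw [hS', iteratedDeriv_expSol_eq_zero h1 j k hjk, zero_div]
    rfl
  refine ⟨fun k => ⟨fun j => S j k, ?_⟩, hS, hzero, fun hΛ => ⟨fun k j h => ?_, fun j z h => ?_⟩⟩
  -- Laurent series need a well-ordered support; the degree bound confines it to the finite interval
  -- from `0` to `k`.
  · refine ((Set.finite_Icc (0 : ℤ) k).subset fun j hj => ?_).isPWO
    obtain ⟨h0, h2⟩ := hzero k j hj
    exact ⟨h0, by omega⟩
  · obtain ⟨h0, -⟩ := hzero k j h
    lift j to ℕ using h0
    by_contra hjk
    refine h (H0.ext_value fun z hz => ?_)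
    rw [hS', iteratedDeriv_expSol_of_isHomogeneous_zero hΛ, if_neg (by omega), zero_div]
    rfl
  · change _ = (S (j : ℤ) (2 * j)).value z h
    rw [hS', iteratedDeriv_expSol_of_isHomogeneous_zero hΛ, if_pos rfl, mul_div_assoc,
      mul_div_cancel₀]
    exact_mod_cast (2 * j).factorial_ne_zero

end Sections

end SymbolCalculus

end

/-! ### The main theorem. -/

theorem theorem3 (n : ℕ)
    (Λ : Matrix (Fin (n + 1)) (Fin (n + 1)) (MvPolynomial (Fin (n + 1)) ℂ))
    (hskew : SymbolCalculus.IsSkew Λ)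
    (hjacobi : SymbolCalculus.IsJacobi Λ)
    (hrel : SymbolCalculus.LambdaRelation Λ)
    (A : Matrix (Fin (n + 1)) (Fin (n + 1)) ℂ) (hA : A.IsSymm) :
    ∃ g : ℂ → SymbolCalculus.V n → ℂ, SymbolCalculus.IsDetInvSqrt Λ A g ∧
    ∃ F : ℤ → ℂ → SymbolCalculus.V n → ℂ,
      -- `F(t)` is the exponential of `t A[Z] / μ` on its domain, and there it is a
      -- continuation of the exponential series
      IsOpen (SymbolCalculus.expDomain Λ A) ∧
      SymbolCalculus.IsTimeStar (SymbolCalculus.expDomain Λ A) ∧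
      SymbolCalculus.IsSharpExp Λ A (SymbolCalculus.expDomain Λ A) F ∧
      (∀ (m : ℤ) (z : SymbolCalculus.V n) (N : ℕ),
        iteratedDeriv N (fun t => F m t z) 0 =
          ((SymbolCalculus.sharp Λ (SymbolCalculus.quadOverMu A))^[N]
            SymbolCalculus.oneSeries) m z) ∧
      -- the exponential is unique, and its domain is maximal
      (∀ (D : Set (ℂ × SymbolCalculus.V n)) (G : ℤ → ℂ → SymbolCalculus.V n → ℂ),
        IsOpen D → SymbolCalculus.IsTimeStar D → SymbolCalculus.IsSharpExp Λ A D G →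
          D ⊆ SymbolCalculus.expDomain Λ A ∧
          ∀ m t z, (t, z) ∈ D → G m t z = F m t z) ∧
      -- the closed form
      (∀ m t z, (t, z) ∈ SymbolCalculus.expDomain Λ A →
        F m t z = g t z * SymbolCalculus.expOverMu
          (SymbolCalculus.quadForm
            (SymbolCalculus.lamInvTan (SymbolCalculus.matAt Λ z) (t • A)) z) m) ∧
      (∀ t z, (t, z) ∈ SymbolCalculus.expDomain Λ A →
        SymbolCalculus.matAt Λ z *
            SymbolCalculus.lamInvTan (SymbolCalculus.matAt Λ z) (t • A) =
          (1 / Complex.I) •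
            SymbolCalculus.matTan (Complex.I • (SymbolCalculus.matAt Λ z * (t • A)))) ∧
      (∀ t z, (t, z) ∈ SymbolCalculus.expDomain Λ A →
        IsUnit (SymbolCalculus.matAt Λ z) →
        SymbolCalculus.lamInvTan (SymbolCalculus.matAt Λ z) (t • A) =
          ((1 / Complex.I) • (SymbolCalculus.matAt Λ z)⁻¹) *
            SymbolCalculus.matTan (Complex.I • (SymbolCalculus.matAt Λ z * (t • A)))) ∧
      -- at `t = 1` it is a sum of sections of the sheaves `O(k)`
      (((1 : ℂ), (0 : SymbolCalculus.V n)) ∈ SymbolCalculus.expDomain Λ A →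
        ∃ s : (k : ℕ) → LaurentSeries (SymbolCalculus.H0 n k),
          SymbolCalculus.HasSectionExpansion (fun m => F m 1) s ∧
          (∀ (k : ℕ) (j : ℤ), (s k).coeff j ≠ 0 → 0 ≤ j ∧ 2 * j ≤ k) ∧
          ((∀ α β, (Λ α β).IsHomogeneous 0) →
            (∀ (k : ℕ) (j : ℤ), (s k).coeff j ≠ 0 → (k : ℤ) = 2 * j) ∧
            ∀ (j : ℕ) (z : SymbolCalculus.V n) (h : z ≠ 0),
              F (-(j : ℤ)) 1 z = ((s (2 * j)).coeff (j : ℤ)).value z h)) := by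
  have hΛ := SymbolCalculus.sum_mul_pderiv_eq_zero hskew hjacobi hrel
  have hopen := SymbolCalculus.isOpen_expDomain Λ A
  have hF := SymbolCalculus.isSharpExp_expSol hΛ hskew hA
  refine ⟨fun t z => SymbolCalculus.detInvSqrt (SymbolCalculus.matAt Λ z) A t,
    SymbolCalculus.isDetInvSqrt_detInvSqrt Λ A, SymbolCalculus.expSol Λ A, hopen,
    SymbolCalculus.isTimeStar_expDomain Λ A, hF, fun m z N => ?_,
    fun D G hD hstar hG => hG.eq_expSol hΛ hskew hA hD hstar, fun _ _ _ _ => rfl,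
    fun t z _ => SymbolCalculus.mul_lamInvTan, fun t z _ hunit => ?_,
    SymbolCalculus.exists_laurentSeries_expSol⟩
  · exact hF.iteratedDeriv_zero Λ A hA hopen m (SymbolCalculus.zero_mem_expDomain Λ A z) N
  · rw [Matrix.smul_mul, ← Matrix.mul_smul, ← SymbolCalculus.mul_lamInvTan,
      Matrix.nonsing_inv_mul_cancel_left _ _ ((Matrix.isUnit_iff_isUnit_det _).1 hunit)]
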